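/- For $n\ge 1$ let $T_n=\langle \tau_1,\dots,\tau_{n-1}\mid \tau_i\tau_j=\tau_j\tau_i \text{ for } |i-j|>1\rangle$, and let $F_n$ be the free group on $x_1,\dots,x_n$. Automorphisms act on the right: in a product $fg$ the automorphism $f$ is applied first, i.e. $(fg)(x)=g(f(x))$. For $i\ne j$ let $\varepsilon_{i,j}\in\operatorname{Aut}(F_n)$ be given by $x_i\mapsto x_j^{-1}x_ix_j$ and $x_l\mapsto x_l$ for $l\neq i$, and let $Cb_n\le \operatorname{Aut}(F_n)$ be the subgroup generated by all $\varepsilon_{i,j}$ (the group of basis-conjugating automorphisms). Then the following hold. 1. For every $k\in\mathbb Z$ there is a homomorphism $\varphi_k:T_n\to Cb_n$ with $\varphi_k(\tau_i)=\varepsilon_{i,i+1}^k$ for $1\le i\le n-1$; thus $\varphi_k(\tau_i)$ maps $x_i\mapsto x_{i+1}^{-k}x_ix_{i+1}^{k}$ and $x_j\mapsto x_j$ for $j\ne i$. If $k\ne 0$, then $\varphi_k$ is injective. 2. For every $k\in\mathbb Z$ there is a homomorphism $\psi_{k,k}:T_n\to Cb_n$ with $\psi_{k,k}(\tau_i)=\varepsilon_{i,i+1}^k\varepsilon_{i+1,i}^k$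 for $1\le i\le n-1$; thus $\psi_{k,k}(\tau_i)$ maps $x_i\mapsto x_i^{-k}x_{i+1}^{-k}x_ix_{i+1}^{k}x_i^{k}$, $x_{i+1}\mapsto x_i^{-k}x_{i+1}x_i^{k}$, and $x_j\mapsto x_j$ for $j\ne i,i+1$. If $k\neq 0$, then $\psi_{k,k}$ is injective. 3. Let $F_{3n-2}$ be the free group on $x_1,\dots,x_n,y_{1,1},\dots,y_{1,n-1},y_{2,1},\dots,y_{2,n-1}$. There is a homomorphism $\xi:T_n\to\operatorname{Aut}(F_{3n-2})$ such that, for $1\le i\le n-1$, $\xi(\tau_i)$ maps $x_i\mapsto x_iy_{1,i}$, $x_{i+1}\mapsto x_{i+1}y_{2,i}$, $x_j\mapsto x_j$ for $j\ne i,i+1$, and fixes every $y_{r,m}$ ($r=1,2$, $1\le m\le n-1$). It is injective for $n=3$ and has a nontrivial kernel for every $n\ge 4$. -/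

import Mathlib

/-- The position of the generator `x_i` of `F_n` among the `n` free generators,
for an index `i` of a generator `τ_i` (indices are counted from `0`). -/
def lowIdx {n : ℕ} (i : Fin (n - 1)) : Fin n := ⟨i.1, by omega⟩

/-- The position of the generator `x_{i+1}` of `F_n`. -/
def highIdx {n : ℕ} (i : Fin (n - 1)) : Fin n := ⟨i.1 + 1, by omega⟩

theorem lowIdx_ne_highIdx {n : ℕ} (i : Fin (n - 1)) : lowIdx i ≠ highIdx i := by
  simp [lowIdx, highIdx, Fin.ext_iff]

/-- The defining relations `τ_i τ_j = τ_j τ_i`, `|i - j| > 1`, of `T_n`, written as relators. -/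
def tauRels (n : ℕ) : Set (FreeGroup (Fin (n - 1))) :=
  {r | ∃ i j : Fin (n - 1), 1 < |((i : ℕ) : ℤ) - ((j : ℕ) : ℤ)| ∧
    r = FreeGroup.of i * FreeGroup.of j * (FreeGroup.of i)⁻¹ * (FreeGroup.of j)⁻¹}

/-- The group `T_n = ⟨τ_1, …, τ_{n-1} ∣ τ_i τ_j = τ_j τ_i for |i - j| > 1⟩`. -/
abbrev TGroup (n : ℕ) : Type := PresentedGroup (tauRels n)

/-- The generator `τ_i` of `T_n`. -/
def tau {n : ℕ} (i : Fin (n - 1)) : TGroup n := PresentedGroup.of i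

/-- The automorphism group of `G` acting on the right: in the product `f * g` the automorphism `f`
is applied first and `g` second. (The product of `MulAut G` is the other composition.) -/
abbrev RAut (G : Type) [Group G] : Type := (MulAut G)ᵐᵒᵖ

/-- The image of `x` under an automorphism in `RAut G`. -/
def RAut.act {G : Type} [Group G] (f : RAut G) (x : G) : G := f.unop x

theorem RAut.act_mul {G : Type} [Group G] (f g : RAut G) (x : G) :
    (f * g).act x = g.act (f.act x) := rfl

/-- The automorphism of `F_n` with `x_i ↦ x_j⁻¹ x_i x_j` and `x_l ↦ x_l` for `l ≠ i`. -/
def epsAut {n : ℕ} (i j : Fin n) (h : i ≠ j) : MulAut (FreeGroup (Fin n)) :=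
  MonoidHom.toMulEquiv
    (FreeGroup.lift fun l => if l = i then
      (FreeGroup.of j)⁻¹ * FreeGroup.of i * FreeGroup.of j else FreeGroup.of l)
    (FreeGroup.lift fun l => if l = i then
      FreeGroup.of j * FreeGroup.of i * (FreeGroup.of j)⁻¹ else FreeGroup.of l)
    (by
      ext l
      by_cases hl : l = i
      · simp [hl, h.symm, mul_assoc]
      · simp [hl])
    (by
      ext l
      by_cases hl : l = i
      · simp [hl, h.symm, mul_assoc]
      · simp [hl])

theorem epsAut_of {n : ℕ} (i j : Fin n) (h : i ≠ j) (l : Fin n) :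
    epsAut i j h (FreeGroup.of l) = if l = i then
      (FreeGroup.of j)⁻¹ * FreeGroup.of i * FreeGroup.of j else FreeGroup.of l := by
  simp [epsAut]

/-- The group `Cb_n` of basis-conjugating automorphisms of `F_n`: the subgroup of `Aut(F_n)`
generated by all `ε_{i,j}`, `i ≠ j`. -/
def Cb (n : ℕ) : Subgroup (RAut (FreeGroup (Fin n))) :=
  Subgroup.closure {f | ∃ (i j : Fin n) (h : i ≠ j), f = MulOpposite.op (epsAut i j h)}

/-- The element `ε_{i,j}` of `Cb_n`. -/
def eps {n : ℕ} (i j : Fin n) (h : i ≠ j) : Cb n :=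
  ⟨MulOpposite.op (epsAut i j h), Subgroup.subset_closure ⟨i, j, h, rfl⟩⟩

theorem eps_commute {n : ℕ} {i j k l : Fin n} (h : i ≠ j) (h' : k ≠ l)
    (hik : i ≠ k) (hil : i ≠ l) (hjk : j ≠ k) : Commute (eps i j h) (eps k l h') := by
  apply Subtype.ext
  apply MulOpposite.unop_injective
  apply MulEquiv.toMonoidHom_injective
  ext m
  change epsAut k l h' (epsAut i j h (FreeGroup.of m))
    = epsAut i j h (epsAut k l h' (FreeGroup.of m))
  by_cases hmi : m = i
  · subst hmi
    simp [epsAut_of, hik, hjk]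
  · by_cases hmk : m = k
    · subst hmk
      simp [epsAut_of, hik.symm, hil.symm]
    · simp [epsAut_of, hmi, hmk]

/-- A map on the generators `τ_i` whose values at `i` and `j` commute for `|i - j| > 1` extends
to a homomorphism on `T_n`. -/
def TGroup.lift {n : ℕ} {G : Type} [Group G] (f : Fin (n - 1) → G)
    (hf : ∀ i j : Fin (n - 1), 1 < |((i : ℕ) : ℤ) - ((j : ℕ) : ℤ)| → Commute (f i) (f j)) :
    TGroup n →* G :=
  PresentedGroup.toGroup (f := f) (by
    rintro r ⟨i, j, hij, rfl⟩
    simp [(hf i j hij).eq])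

theorem idx_ne_of_far {n : ℕ} {i j : Fin (n - 1)}
    (h : 1 < |((i : ℕ) : ℤ) - ((j : ℕ) : ℤ)|) :
    lowIdx i ≠ lowIdx j ∧ lowIdx i ≠ highIdx j ∧ highIdx i ≠ lowIdx j ∧
      highIdx i ≠ highIdx j := by
  rw [lt_abs] at h
  simp only [lowIdx, highIdx, ne_eq, Fin.ext_iff]
  omega

/-- The representation `φ_k : T_n → Cb_n`, `τ_i ↦ ε_{i,i+1}^k`. -/
def phi (n : ℕ) (k : ℤ) : TGroup n →* Cb n :=
  TGroup.lift (fun i => eps (lowIdx i) (highIdx i) (lowIdx_ne_highIdx i) ^ k) (by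
    intro i j hij
    obtain ⟨h1, h2, h3, h4⟩ := idx_ne_of_far hij
    exact (eps_commute _ _ h1 h2 h3).zpow_zpow k k)

/-- The representation `ψ_{k,l} : T_n → Cb_n`, `τ_i ↦ ε_{i,i+1}^k ε_{i+1,i}^l`. -/
def psi (n : ℕ) (k l : ℤ) : TGroup n →* Cb n :=
  TGroup.lift (fun i => eps (lowIdx i) (highIdx i) (lowIdx_ne_highIdx i) ^ k *
      eps (highIdx i) (lowIdx i) (lowIdx_ne_highIdx i).symm ^ l) (by
    intro i j hij
    obtain ⟨h1, h2, h3, h4⟩ := idx_ne_of_far hij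
    apply Commute.mul_left <;> apply Commute.mul_right <;> apply Commute.zpow_zpow <;>
      apply eps_commute <;> assumption)

/-- The free generators of `F_{3n-2}`: `x_1, …, x_n` and `y_{1,1}, …, y_{1,n-1}`,
`y_{2,1}, …, y_{2,n-1}` (here `y1 m` and `y2 m`). -/
inductive XYGen (n : ℕ) : Type
  | x (l : Fin n)
  | y1 (m : Fin (n - 1))
  | y2 (m : Fin (n - 1))

/-- The number of these generators is indeed `3n - 2`. -/
theorem XYGen.card (n : ℕ) (hn : 1 ≤ n) : Nat.card (XYGen n) = 3 * n - 2 := by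
  let e : XYGen n ≃ Fin n ⊕ (Fin (n - 1) ⊕ Fin (n - 1)) :=
    { toFun := fun
        | .x l => .inl l
        | .y1 m => .inr (.inl m)
        | .y2 m => .inr (.inr m)
      invFun := fun
        | .inl l => .x l
        | .inr (.inl m) => .y1 m
        | .inr (.inr m) => .y2 m
      left_inv := by rintro (_ | _ | _) <;> rfl
      right_inv := by rintro (_ | _ | _) <;> rfl }
  rw [Nat.card_congr e]
  simp
  omega

/-- The automorphism of `F_{3n-2}` with `x_i ↦ x_i y_{1,i}`, `x_{i+1} ↦ x_{i+1} y_{2,i}`, which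
fixes all the other free generators. -/
def xiAut {n : ℕ} (i : Fin (n - 1)) : MulAut (FreeGroup (XYGen n)) :=
  MonoidHom.toMulEquiv
    (FreeGroup.lift fun
      | .x l => if l = lowIdx i then FreeGroup.of (.x l) * FreeGroup.of (.y1 i)
          else if l = highIdx i then FreeGroup.of (.x l) * FreeGroup.of (.y2 i)
          else FreeGroup.of (.x l)
      | .y1 m => FreeGroup.of (.y1 m)
      | .y2 m => FreeGroup.of (.y2 m))
    (FreeGroup.lift fun
      | .x l => if l = lowIdx i then FreeGroup.of (.x l) * (FreeGroup.of (.y1 i))⁻¹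
          else if l = highIdx i then FreeGroup.of (.x l) * (FreeGroup.of (.y2 i))⁻¹
          else FreeGroup.of (.x l)
      | .y1 m => FreeGroup.of (.y1 m)
      | .y2 m => FreeGroup.of (.y2 m))
    (by
      ext (l | m | m)
      · by_cases h1 : l = lowIdx i
        · simp [h1]
        · by_cases h2 : l = highIdx i
          · simp [h2, (lowIdx_ne_highIdx i).symm]
          · simp [h1, h2]
      · simp
      · simp)
    (by
      ext (l | m | m)
      · by_cases h1 : l = lowIdx i
        · simp [h1]
        · by_cases h2 : l = highIdx i
          · simp [h2, (lowIdx_ne_highIdx i).symm]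
          · simp [h1, h2]
      · simp
      · simp)

theorem xiAut_x {n : ℕ} (i : Fin (n - 1)) (l : Fin n) :
    xiAut i (FreeGroup.of (.x l)) =
      if l = lowIdx i then FreeGroup.of (.x l) * FreeGroup.of (.y1 i)
      else if l = highIdx i then FreeGroup.of (.x l) * FreeGroup.of (.y2 i)
      else FreeGroup.of (.x l) := by
  simp [xiAut]

theorem xiAut_y1 {n : ℕ} (i m : Fin (n - 1)) :
    xiAut i (FreeGroup.of (.y1 m)) = FreeGroup.of (.y1 m) := by
  simp [xiAut]

theorem xiAut_y2 {n : ℕ} (i m : Fin (n - 1)) :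
    xiAut i (FreeGroup.of (.y2 m)) = FreeGroup.of (.y2 m) := by
  simp [xiAut]

/-- The representation `ξ : T_n → Aut(F_{3n-2})`. -/
def xi (n : ℕ) : TGroup n →* RAut (FreeGroup (XYGen n)) :=
  TGroup.lift (fun i => MulOpposite.op (xiAut i)) (by
    intro i j hij
    obtain ⟨h1, h2, h3, h4⟩ := idx_ne_of_far hij
    apply MulOpposite.unop_injective
    apply MulEquiv.toMonoidHom_injective
    ext g
    change xiAut j (xiAut i (FreeGroup.of g)) = xiAut i (xiAut j (FreeGroup.of g))
    rcases g with l | m | m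
    · by_cases a : l = lowIdx i
      · subst a
        simp [xiAut_x, xiAut_y1, h1, h2]
      · by_cases b : l = highIdx i
        · subst b
          simp [xiAut_x, xiAut_y2, h3, h4, (lowIdx_ne_highIdx i).symm]
        · by_cases c : l = lowIdx j
          · subst c
            simp [xiAut_x, xiAut_y1, h1.symm, h3.symm]
          · by_cases d : l = highIdx j
            · subst d
              simp [xiAut_x, xiAut_y2, h2.symm, h4.symm, (lowIdx_ne_highIdx j).symm]
            · simp [xiAut_x, a, b, c, d]
    · simp [xiAut_y1]
    · simp [xiAut_y2])

/-! Indices start at 0, as in the code.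

ξ. Each x_l is only multiplied on the right by words in the y's, which ξ(T_n) fixes. The action on
x_l is therefore recorded by a homomorphism to a free group, and ker ξ is the intersection of the
kernels of these (`mem_ker_xi`). For n = 3 the middle x is moved by both generators, and its
homomorphism has a left inverse. For n ≥ 4 every x_l is left alone by τ_0 or by τ_2, so
[[τ_0,τ_1],[τ_2,τ_1]] is in the kernel; mapping τ_0, τ_1, τ_2 to adjacent transpositions of S_4
shows that it is nontrivial.

φ_k. The group ⟨τ_p, τ_{p+1}, …⟩ is handled like an HNN extension with base ⟨τ_{p+1}, …⟩ and stable
letter τ_p commuting with ⟨τ_{p+2}, …⟩. Up to a right factor in the base, an element outside the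
base is a reduced product containing τ_p. It conjugates x_p by a word in which nonzero powers of
x_{p+1} alternate with nontrivial elements of ⟨x_{p+2}, …⟩, so it moves x_p. The separating elements
are nontrivial because, by the same claim for p+1, base elements fixing x_{p+1} lie in ⟨τ_{p+2}, …⟩.
This downward induction is `mem_tauGe_succ_of_phiAct_eq`; a kernel element fixes every x_p and thus
descends to the trivial subgroup.

ψ_{k,k}. Raising generators to k-th powers is injective and intertwines ψ_{1,1} with ψ_{k,k}, which
reduces the claim to k = 1. Letting the x_j act as involutions on two copies of a free group turns
ψ_{1,1}(τ_i) into the transvection y_i ↦ y_i y_{i+1}^{-2}, y_{i+2} ↦ y_{i+1}^2 y_{i+2}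
(`involutionRep_psi_tau`). These transvections act faithfully by ping-pong
(`TGroup.exists_mem_of_pingPong`): the i-th set consists of the reduced words containing
y_{i+1}^{±2}. -/

/-! ### Right actions and generation of T_n -/

@[simp] theorem RAut.act_one_right {G : Type} [Group G] (f : RAut G) : f.act 1 = 1 :=
  map_one f.unop

theorem RAut.act_map_mul {G : Type} [Group G] (f : RAut G) (x y : G) :
    f.act (x * y) = f.act x * f.act y := map_mul f.unop x y

theorem RAut.act_map_inv {G : Type} [Group G] (f : RAut G) (x : G) :
    f.act x⁻¹ = (f.act x)⁻¹ := map_inv f.unop x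

theorem RAut.act_map_zpow {G : Type} [Group G] (f : RAut G) (x : G) (k : ℤ) :
    f.act (x ^ k) = f.act x ^ k := map_zpow f.unop x k

theorem RAut.one_act {G : Type} [Group G] (x : G) : (1 : RAut G).act x = x := rfl

theorem RAut.ext_of {α : Type} {f g : RAut (FreeGroup α)}
    (h : ∀ a, f.act (FreeGroup.of a) = g.act (FreeGroup.of a)) : f = g := by
  apply MulOpposite.unop_injective
  apply MulEquiv.toMonoidHom_injective
  ext a
  exact h a

theorem TGroup.lift_tau {n : ℕ} {G : Type} [Group G] (f : Fin (n - 1) → G)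
    (hf : ∀ i j : Fin (n - 1), 1 < |((i : ℕ) : ℤ) - ((j : ℕ) : ℤ)| → Commute (f i) (f j))
    (i : Fin (n - 1)) : TGroup.lift f hf (tau i) = f i :=
  PresentedGroup.toGroup.of _

theorem tau_commute {n : ℕ} {i j : Fin (n - 1)}
    (h : 1 < |((i : ℕ) : ℤ) - ((j : ℕ) : ℤ)|) : Commute (tau i) (tau j) := by
  have h1 : PresentedGroup.mk (tauRels n)
      (FreeGroup.of i * FreeGroup.of j * (FreeGroup.of i)⁻¹ * (FreeGroup.of j)⁻¹) = 1 :=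
    (QuotientGroup.eq_one_iff _).2 (Subgroup.subset_normalClosure ⟨i, j, h, rfl⟩)
  simp only [map_mul, map_inv] at h1
  rwa [mul_inv_eq_one, mul_inv_eq_iff_eq_mul] at h1

theorem closure_range_tau (n : ℕ) :
    Subgroup.closure (Set.range (tau : Fin (n - 1) → TGroup n)) = ⊤ :=
  PresentedGroup.closure_range_of _

/-- Induction over products of powers of the generators of `T_n`. -/
theorem TGroup.induction_zpow {n : ℕ} {p : TGroup n → Prop} (one : p 1)
    (mul : ∀ g i (m : ℤ), p g → p (g * tau i ^ m)) (g : TGroup n) : p g := by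
  have hg : g ∈ Subgroup.closure (Set.range (tau : Fin (n - 1) → TGroup n)) := by
    rw [closure_range_tau]; trivial
  induction hg using Subgroup.closure_induction_right with
  | one => exact one
  | mul_right x hx y hy ih =>
    obtain ⟨i, rfl⟩ := hy
    simpa using mul x i 1 ih
  | mul_inv_cancel x hx y hy ih =>
    obtain ⟨i, rfl⟩ := hy
    simpa using mul x i (-1) ih

/-! ### The representation ξ -/

section Xi

open scoped commutatorElement

theorem xi_tau {n : ℕ} (i : Fin (n - 1)) : xi n (tau i) = MulOpposite.op (xiAut i) :=
  TGroup.lift_tau _ _ i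

theorem xi_tau_act {n : ℕ} (i : Fin (n - 1)) (x : FreeGroup (XYGen n)) :
    (xi n (tau i)).act x = xiAut i x := by
  rw [xi_tau]; rfl

/-- The action of `ξ` on `x_l` is right multiplication by the inverse of this homomorphism. -/
def xiCocycle {n : ℕ} (l : Fin n) : TGroup n →* FreeGroup (XYGen n) :=
  TGroup.lift (fun i => if l = lowIdx i then (FreeGroup.of (.y1 i))⁻¹
      else if l = highIdx i then (FreeGroup.of (.y2 i))⁻¹ else 1) (by
    intro i j hij
    obtain ⟨h1, h2, h3, h4⟩ := idx_ne_of_far hij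
    by_cases a : l = lowIdx i
    · subst a; simp [h1, h2]
    · by_cases b : l = highIdx i
      · subst b; simp [h3, h4]
      · simp [a, b])

theorem xiCocycle_tau {n : ℕ} (l : Fin n) (i : Fin (n - 1)) :
    xiCocycle l (tau i) = if l = lowIdx i then (FreeGroup.of (.y1 i))⁻¹
      else if l = highIdx i then (FreeGroup.of (.y2 i))⁻¹ else 1 :=
  TGroup.lift_tau _ _ i

theorem xi_act_xiCocycle {n : ℕ} (l : Fin n) (i : Fin (n - 1)) (g : TGroup n) :
    (xi n (tau i)).act (xiCocycle l g) = xiCocycle l g := by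
  have h : (xiAut i).toMonoidHom.comp (xiCocycle l) = xiCocycle l := by
    apply PresentedGroup.ext
    intro j
    change xiAut i (xiCocycle l (tau j)) = xiCocycle l (tau j)
    rw [xiCocycle_tau]
    split_ifs <;> simp [xiAut_y1, xiAut_y2]
  rw [xi_tau_act]
  exact DFunLike.congr_fun h g

/-- If s and t multiply x_l by a_s and a_t, then st multiplies it by a_t a_s, since t fixes a_s.
Increments thus compose in reverse order, and their inverses form a homomorphism. -/
theorem xi_act_x {n : ℕ} (l : Fin n) (g : TGroup n) :
    (xi n g).act (FreeGroup.of (.x l)) = FreeGroup.of (.x l) * (xiCocycle l g)⁻¹ := by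
  have hg : g ∈ Subgroup.closure (Set.range (tau : Fin (n - 1) → TGroup n)) := by
    rw [closure_range_tau]; trivial
  have key : ∀ i : Fin (n - 1), (xi n (tau i)).act (FreeGroup.of (.x l)) =
      FreeGroup.of (.x l) * (xiCocycle l (tau i))⁻¹ := by
    intro i
    rw [xi_tau_act, xiAut_x, xiCocycle_tau]
    split_ifs <;> simp
  induction hg using Subgroup.closure_induction_right with
  | one => simp [RAut.one_act]
  | mul_right x hx y hy ih =>
    obtain ⟨i, rfl⟩ := hy
    rw [map_mul, RAut.act_mul, ih, RAut.act_map_mul, RAut.act_map_inv, xi_act_xiCocycle, key]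
    simp [mul_assoc]
  | mul_inv_cancel x hx y hy ih =>
    obtain ⟨i, rfl⟩ := hy
    apply (xi n (tau i)).unop.injective
    change (xi n (tau i)).act _ = (xi n (tau i)).act _
    rw [← RAut.act_mul, ← map_mul, inv_mul_cancel_right, ih, RAut.act_map_mul,
      RAut.act_map_inv, xi_act_xiCocycle, key]
    simp [mul_assoc]

theorem xi_act_y {n : ℕ} (g : TGroup n) (m : Fin (n - 1)) :
    (xi n g).act (FreeGroup.of (.y1 m)) = FreeGroup.of (.y1 m) ∧
      (xi n g).act (FreeGroup.of (.y2 m)) = FreeGroup.of (.y2 m) := by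
  induction g using TGroup.induction_zpow with
  | one => simp [RAut.one_act]
  | mul g i k ih =>
    have h1 : ∀ z : FreeGroup (XYGen n), xiAut i z = z → (xi n (tau i ^ k)).act z = z := by
      intro z hz
      rw [map_zpow, xi_tau]
      have : xiAut i ∈ MulAction.stabilizer (MulAut (FreeGroup (XYGen n))) z := hz
      exact zpow_mem this k
    rw [map_mul, RAut.act_mul, RAut.act_mul, ih.1, ih.2]
    exact ⟨h1 _ (xiAut_y1 i m), h1 _ (xiAut_y2 i m)⟩

theorem mem_ker_xi {n : ℕ} {g : TGroup n} : g ∈ (xi n).ker ↔ ∀ l, xiCocycle l g = 1 := by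
  rw [MonoidHom.mem_ker]
  constructor
  · intro h l
    have := xi_act_x l g
    rw [h, RAut.one_act] at this
    simpa using this
  · intro h
    apply RAut.ext_of
    rintro (l | m | m)
    · rw [xi_act_x, h l]; simp [RAut.one_act]
    · exact (xi_act_y g m).1
    · exact (xi_act_y g m).2

theorem xi_three_injective : Function.Injective (xi 3) := by
  rw [← MonoidHom.ker_eq_bot_iff, eq_bot_iff]
  intro g hg
  rw [mem_ker_xi] at hg
  -- A left inverse of the homomorphism at the middle generator, index 1, which both τ's move.
  let r : FreeGroup (XYGen 3) →* TGroup 3 := FreeGroup.lift fun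
    | .x _ => 1
    | .y1 m => (tau m)⁻¹
    | .y2 m => (tau m)⁻¹
  have h : r.comp (xiCocycle 1) = MonoidHom.id _ := by
    apply PresentedGroup.ext
    intro i
    change r (xiCocycle 1 (tau i)) = tau i
    rw [xiCocycle_tau]
    have hi : (1 : Fin 3) = lowIdx i ∨ (1 : Fin 3) = highIdx i := by
      revert i; decide
    rcases hi with hi | hi
    · simp [← hi, r]
    · have : (1 : Fin 3) ≠ lowIdx i := fun h => lowIdx_ne_highIdx i (h.symm.trans hi)
      rw [if_neg this, if_pos hi]
      simp [r]
  have := DFunLike.congr_fun h g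
  simpa [hg 1] using this.symm

theorem xi_ker_ne_bot {n : ℕ} (hn : 4 ≤ n) : (xi n).ker ≠ ⊥ := by
  intro h
  let t0 : Fin (n - 1) := ⟨0, by omega⟩
  let t1 : Fin (n - 1) := ⟨1, by omega⟩
  let t2 : Fin (n - 1) := ⟨2, by omega⟩
  -- Killing τ_0 or τ_2 kills one of the two inner commutators, and hence the outer one.
  have hker : ⁅⁅tau t0, tau t1⁆, ⁅tau t2, tau t1⁆⁆ ∈ (xi n).ker := by
    rw [mem_ker_xi]
    intro l
    have : xiCocycle l (tau t0) = 1 ∨ xiCocycle l (tau t2) = 1 := by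
      rw [xiCocycle_tau, xiCocycle_tau]
      by_cases a : l.1 ≤ 1
      · right
        rw [if_neg, if_neg] <;> simp [lowIdx, highIdx, Fin.ext_iff, t2] <;> omega
      · left
        rw [if_neg, if_neg] <;> simp [lowIdx, highIdx, Fin.ext_iff, t0] <;> omega
    rcases this with h | h <;> simp [map_commutatorElement, h]
  rw [h, Subgroup.mem_bot] at hker
  -- In S_4 the inner commutators become 3-cycles on {0,1,2} and on {1,2,3}, which do not commute.
  let a : Equiv.Perm (Fin 4) := Equiv.swap 0 1
  let b : Equiv.Perm (Fin 4) := Equiv.swap 1 2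
  let c : Equiv.Perm (Fin 4) := Equiv.swap 2 3
  let F : TGroup n →* Equiv.Perm (Fin 4) :=
    TGroup.lift (fun i => if i.1 = 0 then a else if i.1 = 1 then b else if i.1 = 2 then c else 1)
      (by
        intro i j hij
        have hac : Commute a c := by unfold Commute SemiconjBy; decide
        rw [lt_abs] at hij
        split_ifs <;> first
          | exact hac
          | exact hac.symm
          | exact Commute.one_left _
          | exact Commute.one_right _
          | exact Commute.refl _
          | omega)
  have hF := congrArg F hker
  have h0 : F (tau t0) = a := by simp [F, TGroup.lift_tau, t0]
  have h1 : F (tau t1) = b := by simp [F, TGroup.lift_tau, t1]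
  have h2 : F (tau t2) = c := by simp [F, TGroup.lift_tau, t2]
  rw [map_commutatorElement, map_commutatorElement, map_commutatorElement, h0, h1, h2,
    map_one] at hF
  revert hF
  decide

end Xi

/-! ### Reduced words and alternating products -/

section Words

variable {α : Type} [DecidableEq α]

theorem FreeGroup.toWord_of_zpow (a : α) (z : ℤ) :
    (FreeGroup.of a ^ z).toWord = List.replicate z.natAbs (a, decide (0 < z)) := by
  obtain ⟨m, rfl | rfl⟩ := z.eq_nat_or_neg
  · rw [zpow_natCast, FreeGroup.toWord_of_pow]
    rcases m with _ | m
    · simp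
    · simp; omega
  · rw [zpow_neg, zpow_natCast, FreeGroup.toWord_inv, FreeGroup.toWord_of_pow]
    simp [FreeGroup.invRev]

theorem FreeGroup.toWord_mul_of_reduced {x y : FreeGroup α}
    (h : ∀ a ∈ x.toWord.getLast?, ∀ b ∈ y.toWord.head?, a.1 = b.1 → a.2 = b.2) :
    (x * y).toWord = x.toWord ++ y.toWord := by
  rw [FreeGroup.toWord_mul]
  apply FreeGroup.IsReduced.reduce_eq
  exact List.isChain_append.2 ⟨FreeGroup.isReduced_toWord, FreeGroup.isReduced_toWord, h⟩

theorem FreeGroup.fst_mem_of_mem_toWord {S : Set α} {g : FreeGroup α}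
    (hg : g ∈ Subgroup.closure (FreeGroup.of '' S)) : ∀ p ∈ g.toWord, p.1 ∈ S := by
  induction hg using Subgroup.closure_induction with
  | mem x hx => obtain ⟨a, ha, rfl⟩ := hx; simpa using ha
  | one => simp
  | mul x y hx hy ihx ihy =>
    intro p hp
    have := (FreeGroup.toWord_mul_sublist x y).subset hp
    rcases List.mem_append.1 this with h | h
    · exact ihx p h
    · exact ihy p h
  | inv x hx ih =>
    intro p hp
    rw [FreeGroup.toWord_inv, FreeGroup.invRev, List.mem_reverse, List.mem_map] at hp
    obtain ⟨p', h, rfl⟩ := hp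
    exact ih p' h

/-- Products `x_q^{a_1} g_1 x_q^{a_2} g_2 ⋯ x_q^{a_r} g_r` with nonzero exponents `a_i`, and with
`g_i` in the subgroup `K`, nontrivial for `i < r`. -/
inductive FreeGroup.Alternating (q : α) (K : Subgroup (FreeGroup α)) : FreeGroup α → Prop
  | base (a : ℤ) (ha : a ≠ 0) (g : FreeGroup α) (hg : g ∈ K) :
      Alternating q K (FreeGroup.of q ^ a * g)
  | step (a : ℤ) (ha : a ≠ 0) (g : FreeGroup α) (hg : g ∈ K) (hg1 : g ≠ 1) (u : FreeGroup α)
      (hu : Alternating q K u) : Alternating q K (FreeGroup.of q ^ a * g * u)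

theorem FreeGroup.toWord_of_zpow_mul {q : α} {a : ℤ} {g : FreeGroup α}
    (hg : ∀ p ∈ g.toWord, p.1 ≠ q) :
    (FreeGroup.of q ^ a * g).toWord =
      List.replicate a.natAbs (q, decide (0 < a)) ++ g.toWord := by
  rw [FreeGroup.toWord_mul_of_reduced, FreeGroup.toWord_of_zpow]
  intro x hx y hy hxy
  rw [FreeGroup.toWord_of_zpow] at hx
  have h1 := List.eq_of_mem_replicate (List.mem_of_getLast? hx)
  exact absurd (hxy.symm.trans (congrArg Prod.fst h1)) (hg y (List.mem_of_head? hy))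

/-- Nothing cancels at a junction: an intermediate g is nontrivial and ends in a letter other than
q, while the next factor begins with q. -/
theorem FreeGroup.Alternating.exists_toWord_eq {q : α} {K : Subgroup (FreeGroup α)}
    (hK : ∀ g ∈ K, ∀ p ∈ g.toWord, p.1 ≠ q) {u : FreeGroup α}
    (hu : FreeGroup.Alternating q K u) : ∃ b L, u.toWord = (q, b) :: L := by
  have key : ∀ a : ℤ, a ≠ 0 → ∀ L : List (α × Bool), ∃ b L',
      List.replicate a.natAbs (q, decide (0 < a)) ++ L = (q, b) :: L' := by
    intro a ha L
    obtain ⟨m, hm⟩ := Nat.exists_eq_succ_of_ne_zero (Int.natAbs_ne_zero.2 ha)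
    rw [hm, List.replicate_succ]
    exact ⟨_, _, rfl⟩
  induction hu with
  | base a ha g hg =>
    rw [FreeGroup.toWord_of_zpow_mul (hK g hg)]
    exact key a ha _
  | step a ha g hg hg1 u hu ih =>
    obtain ⟨b, L, h⟩ := ih
    rw [FreeGroup.toWord_mul_of_reduced, FreeGroup.toWord_of_zpow_mul (hK g hg),
      List.append_assoc]
    · exact key a ha _
    · intro x hx y hy hxy
      rw [FreeGroup.toWord_of_zpow_mul (hK g hg), List.getLast?_append_of_ne_nil _ (by simpa)]
        at hx
      rw [h, List.head?_cons, Option.mem_some_iff] at hy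
      subst hy
      exact absurd hxy (hK g hg x (List.mem_of_getLast? hx))

theorem FreeGroup.Alternating.ne_one {q : α} {K : Subgroup (FreeGroup α)}
    (hK : ∀ g ∈ K, ∀ p ∈ g.toWord, p.1 ≠ q) {u : FreeGroup α}
    (hu : FreeGroup.Alternating q K u) : u ≠ 1 := by
  rintro rfl
  obtain ⟨b, L, h⟩ := hu.exists_toWord_eq hK
  simp at h

/-- An element of a free factor commuting with a complementary free generator is trivial. -/
theorem FreeGroup.eq_one_of_conj_eq {q : α} {K : Subgroup (FreeGroup α)}
    (hK : ∀ g ∈ K, ∀ p ∈ g.toWord, p.1 ≠ q) {u : FreeGroup α} (hu : u ∈ K)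
    (h : u⁻¹ * FreeGroup.of q * u = FreeGroup.of q) : u = 1 := by
  by_contra hu1
  -- The commutator of q and u is alternating, so it cannot be trivial.
  have h1 : FreeGroup.Alternating q K
      (FreeGroup.of q ^ (1 : ℤ) * u * (FreeGroup.of q ^ (-1 : ℤ) * u⁻¹)) :=
    .step 1 one_ne_zero u hu hu1 _ (.base (-1) (by simp) _ (inv_mem hu))
  apply h1.ne_one hK
  have h2 : FreeGroup.of q * u = u * FreeGroup.of q := by
    rw [mul_assoc, inv_mul_eq_iff_eq_mul] at h; exact h
  simp only [zpow_one, zpow_neg, h2]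
  group

end Words

/-! ### Powers of ε_{i,j} -/

section Eps

variable {n : ℕ}

theorem epsAut_inv_of (i j : Fin n) (h : i ≠ j) (l : Fin n) :
    (epsAut i j h)⁻¹ (FreeGroup.of l) = if l = i then
      FreeGroup.of j * FreeGroup.of i * (FreeGroup.of j)⁻¹ else FreeGroup.of l := by
  change (epsAut i j h).symm (FreeGroup.of l) = _
  simp [epsAut]

theorem epsAut_zpow_of_ne (i j : Fin n) (h : i ≠ j) (k : ℤ) {l : Fin n} (hl : l ≠ i) :
    (epsAut i j h ^ k) (FreeGroup.of l) = FreeGroup.of l := by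
  have : epsAut i j h ∈
      MulAction.stabilizer (MulAut (FreeGroup (Fin n))) (FreeGroup.of l) := by
    change epsAut i j h (FreeGroup.of l) = FreeGroup.of l
    rw [epsAut_of, if_neg hl]
  exact zpow_mem this k

theorem epsAut_zpow_of_self (i j : Fin n) (h : i ≠ j) (k : ℤ) :
    (epsAut i j h ^ k) (FreeGroup.of i) =
      FreeGroup.of j ^ (-k) * FreeGroup.of i * FreeGroup.of j ^ k := by
  induction k using Int.induction_on with
  | zero => simp
  | succ k ih =>
    rw [zpow_add_one, MulAut.mul_apply, epsAut_of, if_pos rfl, map_mul, map_mul, map_inv, ih,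
      epsAut_zpow_of_ne _ _ _ _ h.symm]
    group
  | pred k ih =>
    rw [zpow_sub_one, MulAut.mul_apply, epsAut_inv_of, if_pos rfl, map_mul, map_mul, map_inv, ih,
      epsAut_zpow_of_ne _ _ _ _ h.symm]
    group

theorem eps_zpow_act (i j : Fin n) (h : i ≠ j) (k : ℤ) (x : FreeGroup (Fin n)) :
    (eps i j h ^ k).1.act x = (epsAut i j h ^ k) x := by
  rw [SubgroupClass.coe_zpow]; rfl

end Eps

/-! ### Faithfulness of φ_k through stabilizers -/

section Phi

variable {n : ℕ}

theorem phi_tau (k : ℤ) (i : Fin (n - 1)) :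
    phi n k (tau i) = eps (lowIdx i) (highIdx i) (lowIdx_ne_highIdx i) ^ k :=
  TGroup.lift_tau _ _ i

/-- The image of `x` under `φ_k(t)`. -/
def phiAct (k : ℤ) (t : TGroup n) (x : FreeGroup (Fin n)) : FreeGroup (Fin n) :=
  (phi n k t).1.act x

variable (k : ℤ)

theorem phiAct_one (x : FreeGroup (Fin n)) : phiAct k 1 x = x := by
  rw [phiAct, map_one]; rfl

theorem phiAct_mul (s t : TGroup n) (x : FreeGroup (Fin n)) :
    phiAct k (s * t) x = phiAct k t (phiAct k s x) := by
  rw [phiAct, map_mul]; rfl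

theorem phiAct_map_mul (t : TGroup n) (x y : FreeGroup (Fin n)) :
    phiAct k t (x * y) = phiAct k t x * phiAct k t y := map_mul _ x y

theorem phiAct_map_one (t : TGroup n) : phiAct k t 1 = 1 :=
  RAut.act_one_right _

theorem phiAct_map_inv (t : TGroup n) (x : FreeGroup (Fin n)) :
    phiAct k t x⁻¹ = (phiAct k t x)⁻¹ := map_inv (phi n k t).1.unop x

theorem phiAct_map_zpow (t : TGroup n) (x : FreeGroup (Fin n)) (m : ℤ) :
    phiAct k t (x ^ m) = phiAct k t x ^ m := map_zpow (phi n k t).1.unop x m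

theorem phiAct_injective (t : TGroup n) : Function.Injective (phiAct k t) :=
  (phi n k t).1.unop.injective

theorem phiAct_tau_zpow_low (i : Fin (n - 1)) (m : ℤ) :
    phiAct k (tau i ^ m) (FreeGroup.of (lowIdx i)) =
      FreeGroup.of (highIdx i) ^ (-(k * m)) * FreeGroup.of (lowIdx i) *
        FreeGroup.of (highIdx i) ^ (k * m) := by
  rw [phiAct, map_zpow, phi_tau, ← zpow_mul, eps_zpow_act, epsAut_zpow_of_self]

theorem phiAct_tau_zpow_of_ne (i : Fin (n - 1)) (m : ℤ) {l : Fin n} (hl : l ≠ lowIdx i) :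
    phiAct k (tau i ^ m) (FreeGroup.of l) = FreeGroup.of l := by
  rw [phiAct, map_zpow, phi_tau, ← zpow_mul, eps_zpow_act, epsAut_zpow_of_ne _ _ _ _ hl]

/-- The subgroup of `T_n` generated by the `τ_i` with `p ≤ i`. -/
def tauGe (n p : ℕ) : Subgroup (TGroup n) := Subgroup.closure (tau '' {i | p ≤ i.1})

/-- The subgroup of `F_n` generated by the `x_j` with `p ≤ j`. -/
def genGe (n p : ℕ) : Subgroup (FreeGroup (Fin n)) :=
  Subgroup.closure (FreeGroup.of '' {j | p ≤ j.1})

theorem genGe_mono {p q : ℕ} (h : p ≤ q) : genGe n q ≤ genGe n p :=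
  Subgroup.closure_mono (Set.image_mono fun _ hi => h.trans hi)

theorem tau_mem_tauGe {p : ℕ} {i : Fin (n - 1)} (h : p ≤ i.1) : tau i ∈ tauGe n p :=
  Subgroup.subset_closure ⟨i, h, rfl⟩

theorem of_mem_genGe {p : ℕ} {j : Fin n} (h : p ≤ j.1) : FreeGroup.of j ∈ genGe n p :=
  Subgroup.subset_closure ⟨j, h, rfl⟩

theorem genGe_toWord {p : ℕ} {q : Fin n} (h : q.1 < p) :
    ∀ g ∈ genGe n p, ∀ l ∈ g.toWord, l.1 ≠ q := by
  intro g hg l hl e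
  have : p ≤ l.1.1 := FreeGroup.fst_mem_of_mem_toWord hg l hl
  rw [e] at this
  omega

theorem tauGe_induction {q : ℕ} {P : ∀ t, t ∈ tauGe n q → Prop} (one : P 1 (one_mem _))
    (mul : ∀ t (ht : t ∈ tauGe n q) (i : Fin (n - 1)) (hi : q ≤ i.1) (m : ℤ), m ≠ 0 → P t ht →
      P (t * tau i ^ m) (mul_mem ht (zpow_mem (tau_mem_tauGe hi) m)))
    {t : TGroup n} (ht : t ∈ tauGe n q) : P t ht := by
  induction ht using Subgroup.closure_induction_right with
  | one => exact one
  | mul_right x hx y hy ih =>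
    obtain ⟨i, hi, rfl⟩ := hy
    simpa using mul x hx i hi 1 one_ne_zero ih
  | mul_inv_cancel x hx y hy ih =>
    obtain ⟨i, hi, rfl⟩ := hy
    simpa using mul x hx i hi (-1) (by simp) ih

theorem commute_of_mem_tauGe {p : Fin (n - 1)} {m : ℤ} {h : TGroup n} (hh : h ∈ tauGe n (p.1 + 2)) :
    Commute h (tau p ^ m) := by
  apply Commute.zpow_right
  induction hh using tauGe_induction with
  | one => exact Commute.one_left _
  | mul t ht i hi m hm ih =>
    refine ih.mul_left (Commute.zpow_left (tau_commute ?_) m)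
    rw [lt_abs]
    omega

theorem phiAct_of_lt {q : ℕ} {h : TGroup n} (hh : h ∈ tauGe n q) {j : Fin n} (hj : j.1 < q) :
    phiAct k h (FreeGroup.of j) = FreeGroup.of j := by
  induction hh using tauGe_induction with
  | one => exact phiAct_one k _
  | mul t ht i hi m hm ih =>
    rw [phiAct_mul, ih, phiAct_tau_zpow_of_ne]
    simp only [lowIdx, ne_eq, Fin.ext_iff]
    omega

theorem phiAct_tau_zpow_mem_genGe {p : ℕ} (i : Fin (n - 1)) (m : ℤ) {g : FreeGroup (Fin n)}
    (hg : g ∈ genGe n p) : phiAct k (tau i ^ m) g ∈ genGe n p := by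
  induction hg using Subgroup.closure_induction with
  | mem x hx =>
    obtain ⟨j, hj, rfl⟩ := hx
    by_cases hji : j = lowIdx i
    · subst hji
      have h1 : p ≤ i.1 := hj
      have h2 : FreeGroup.of (highIdx i) ∈ genGe n p :=
        of_mem_genGe (by simp only [highIdx]; omega)
      have h3 : FreeGroup.of (lowIdx i) ∈ genGe n p := of_mem_genGe h1
      rw [phiAct_tau_zpow_low]
      exact Subgroup.mul_mem _ (Subgroup.mul_mem _ (Subgroup.zpow_mem _ h2 _) h3)
        (Subgroup.zpow_mem _ h2 _)
    · rw [phiAct_tau_zpow_of_ne _ _ _ hji]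
      exact of_mem_genGe hj
  | one => rw [phiAct_map_one]; exact one_mem _
  | mul x y hx hy ihx ihy => rw [phiAct_map_mul]; exact mul_mem ihx ihy
  | inv x hx ih => rw [phiAct_map_inv]; exact inv_mem ih

theorem phiAct_mem_genGe {p : ℕ} {h : TGroup n} {g : FreeGroup (Fin n)} (hg : g ∈ genGe n p) :
    phiAct k h g ∈ genGe n p := by
  induction h using TGroup.induction_zpow with
  | one => rwa [phiAct_one]
  | mul h i m ih =>
    rw [phiAct_mul]
    exact phiAct_tau_zpow_mem_genGe k i m ih

theorem exists_phiAct_eq_conj {p : Fin n} {h : TGroup n} (hh : h ∈ tauGe n p) :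
    ∃ v ∈ genGe n (p.1 + 1), phiAct k h (FreeGroup.of p) = v⁻¹ * FreeGroup.of p * v := by
  induction hh using tauGe_induction with
  | one => exact ⟨1, one_mem _, by simp [phiAct_one]⟩
  | mul t ht i hi m hm ih =>
    obtain ⟨v, hv, e⟩ := ih
    rw [phiAct_mul, e, phiAct_map_mul, phiAct_map_mul, phiAct_map_inv]
    have hv' := phiAct_mem_genGe k (h := tau i ^ m) hv
    by_cases hpi : p = lowIdx i
    · subst hpi
      have h2 : FreeGroup.of (highIdx i) ∈ genGe n ((lowIdx i).1 + 1) := of_mem_genGe le_rfl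
      refine ⟨FreeGroup.of (highIdx i) ^ (k * m) * phiAct k (tau i ^ m) v,
        Subgroup.mul_mem _ (Subgroup.zpow_mem _ h2 _) hv', ?_⟩
      rw [phiAct_tau_zpow_low]
      group
    · exact ⟨_, hv', by rw [phiAct_tau_zpow_of_ne _ _ _ hpi]⟩

/-- Elements `t_0 τ_p^{m_1} t_1 ⋯ t_{r-1} τ_p^{m_r}`, `r ≥ 1`, where the `t_i` involve only the
generators after `τ_p`, and no `t_i` with `0 < i` can be moved across `τ_p`. -/
inductive TauReduced (p : Fin (n - 1)) : TGroup n → Prop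
  | base (t : TGroup n) (ht : t ∈ tauGe n (p.1 + 1)) (m : ℤ) (hm : m ≠ 0) :
      TauReduced p (t * tau p ^ m)
  | step (s : TGroup n) (hs : TauReduced p s) (t : TGroup n) (ht : t ∈ tauGe n (p.1 + 1))
      (ht' : t ∉ tauGe n (p.1 + 2)) (m : ℤ) (hm : m ≠ 0) : TauReduced p (s * t * tau p ^ m)

/-- The new power merges with the last one; if the exponents cancel, the preceding t becomes the
right factor. -/
theorem TauReduced.mul_zpow {p : Fin (n - 1)} {s : TGroup n} (hs : TauReduced p s) (m : ℤ) :
    s * tau p ^ m ∈ tauGe n (p.1 + 1) ∨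
      ∃ s', TauReduced p s' ∧ ∃ h ∈ tauGe n (p.1 + 1), s * tau p ^ m = s' * h := by
  cases hs with
  | base t ht m' hm' =>
    rw [mul_assoc, ← zpow_add]
    by_cases h0 : m' + m = 0
    · left; rwa [h0, zpow_zero, mul_one]
    · exact .inr ⟨_, .base t ht _ h0, 1, one_mem _, (mul_one _).symm⟩
  | step s hs t ht ht' m' hm' =>
    right
    rw [mul_assoc, ← zpow_add]
    by_cases h0 : m' + m = 0
    · exact ⟨s, hs, t, ht, by rw [h0, zpow_zero, mul_one]⟩
    · exact ⟨_, .step s hs t ht ht' _ h0, 1, one_mem _, (mul_one _).symm⟩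

/-- Existence of HNN normal forms. Uniqueness is not needed: the action on x_p separates the two
alternatives. -/
theorem mem_tauGe_or_exists_tauReduced {p : Fin (n - 1)} {t : TGroup n} (ht : t ∈ tauGe n p.1) :
    t ∈ tauGe n (p.1 + 1) ∨ ∃ s, TauReduced p s ∧ ∃ h ∈ tauGe n (p.1 + 1), t = s * h := by
  induction ht using tauGe_induction with
  | one => exact .inl (one_mem _)
  | mul t ht i hi m hm ih =>
    rcases hi.eq_or_lt with hi | hi
    · obtain rfl : p = i := Fin.ext hi
      rcases ih with ih | ⟨s, hs, h, hh, rfl⟩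
      · exact .inr ⟨_, .base t ih m hm, 1, one_mem _, by simp⟩
      · by_cases hh' : h ∈ tauGe n (p.1 + 2)
        · rw [mul_assoc, (commute_of_mem_tauGe hh').eq, ← mul_assoc]
          rcases hs.mul_zpow m with h1 | ⟨s', hs', h', hh', e⟩
          · exact .inl (mul_mem h1 hh)
          · exact .inr ⟨s', hs', h' * h, mul_mem hh' hh, by rw [e, mul_assoc]⟩
        · exact .inr ⟨_, .step s hs h hh hh' m hm, 1, one_mem _, by simp⟩
    · have h1 : tau i ^ m ∈ tauGe n (p.1 + 1) := zpow_mem (tau_mem_tauGe hi) m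
      rcases ih with ih | ⟨s, hs, h, hh, rfl⟩
      · exact .inl (mul_mem ih h1)
      · exact .inr ⟨s, hs, _, mul_mem hh h1, mul_assoc _ _ _⟩

/-- If `h` moves `x_q` to `v⁻¹ x_q v`, it moves alternating elements to `v⁻¹ u'` with `u'`
alternating. -/
theorem exists_phiAct_alternating {q : Fin n} {h : TGroup n} {v : FreeGroup (Fin n)}
    (hv : v ∈ genGe n (q.1 + 1))
    (e : phiAct k h (FreeGroup.of q) = v⁻¹ * FreeGroup.of q * v) {u : FreeGroup (Fin n)}
    (hu : FreeGroup.Alternating q (genGe n (q.1 + 1)) u) :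
    ∃ u', FreeGroup.Alternating q (genGe n (q.1 + 1)) u' ∧ phiAct k h u = v⁻¹ * u' := by
  have hz : ∀ a : ℤ, (v⁻¹ * FreeGroup.of q * v) ^ a = v⁻¹ * FreeGroup.of q ^ a * v := by
    intro a
    simpa using conj_zpow (i := a) (a := v⁻¹) (b := FreeGroup.of q)
  induction hu with
  | base a ha g hg =>
    refine ⟨_, .base a ha (v * phiAct k h g) (mul_mem hv (phiAct_mem_genGe k hg)), ?_⟩
    rw [phiAct_map_mul, phiAct_map_zpow, e, hz]
    group
  | step a ha g hg hg1 u hu ih =>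
    obtain ⟨u', hu', e'⟩ := ih
    -- The v after x_q^a and the v⁻¹ before the tail conjugate the image of g, which keeps it
    -- nontrivial.
    refine ⟨_, .step a ha (v * phiAct k h g * v⁻¹)
      (mul_mem (mul_mem hv (phiAct_mem_genGe k hg)) (inv_mem hv)) ?_ u' hu', ?_⟩
    · rw [Ne, conj_eq_one_iff]
      intro h1
      exact hg1 (phiAct_injective k h (h1.trans (phiAct_map_one k h).symm))
    · rw [phiAct_map_mul, phiAct_map_mul, phiAct_map_zpow, e, hz, e']
      group

theorem FreeGroup.Alternating.mem_genGe {q : Fin n} {u : FreeGroup (Fin n)}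
    (hu : FreeGroup.Alternating q (genGe n (q.1 + 1)) u) : u ∈ genGe n q.1 := by
  have h1 := genGe_mono (n := n) (Nat.le_succ q.1)
  have h2 : FreeGroup.of q ∈ genGe n q.1 := of_mem_genGe le_rfl
  induction hu with
  | base a ha g hg => exact mul_mem (zpow_mem h2 a) (h1 hg)
  | step a ha g hg hg1 u hu ih => exact mul_mem (mul_mem (zpow_mem h2 a) (h1 hg)) ih

/-- The stabilizer of `x_p` in `⟨τ_p, τ_{p+1}, …⟩` is `⟨τ_{p+1}, …⟩`. -/
theorem mem_tauGe_succ_of_phiAct_eq {k : ℤ} (hk : k ≠ 0) (d : ℕ) : ∀ p : Fin n, p.1 + d = n →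
    ∀ t ∈ tauGe n p.1, phiAct k t (FreeGroup.of p) = FreeGroup.of p → t ∈ tauGe n (p.1 + 1) := by
  induction d with
  | zero => intro p hp; omega
  | succ d ih =>
    intro p hp t ht hfix
    by_cases hpn : p.1 + 1 < n
    swap
    -- For the last x_p there is no τ_p, so the generating set is empty.
    · have hbot : tauGe n p.1 ≤ tauGe n (p.1 + 1) := by
        rw [tauGe, Subgroup.closure_le]
        rintro _ ⟨i, hi, rfl⟩
        have : p.1 ≤ i.1 := hi
        omega
      exact hbot ht
    obtain ⟨i, rfl⟩ : ∃ i, p = lowIdx i := ⟨⟨p.1, by omega⟩, rfl⟩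
    have ih' := ih (highIdx i) (by simp only [lowIdx, highIdx] at hp ⊢; omega)
    have red : ∀ s, TauReduced i s → ∃ u,
        FreeGroup.Alternating (highIdx i) (genGe n (i.1 + 2)) u ∧
        phiAct k s (FreeGroup.of (lowIdx i)) = u⁻¹ * FreeGroup.of (lowIdx i) * u := by
      intro s hs
      induction hs with
      | base t ht m hm =>
        refine ⟨_, .base (k * m) (mul_ne_zero hk hm) 1 (one_mem _), ?_⟩
        rw [phiAct_mul, phiAct_of_lt k ht (Nat.lt_succ_self _), phiAct_tau_zpow_low]
        group
      | step s hs t ht ht' m hm ihs =>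
        obtain ⟨u, hu, e⟩ := ihs
        obtain ⟨v, hv, ev⟩ := exists_phiAct_eq_conj k (p := highIdx i) ht
        obtain ⟨u', hu', eu⟩ := exists_phiAct_alternating k hv ev hu
        -- If v were trivial, t would fix x_{p+1}, and the induction hypothesis would put it in
        -- ⟨τ_{p+2}, …⟩.
        have hv1 : v⁻¹ ≠ 1 := by
          intro hv1
          rw [inv_eq_one] at hv1
          subst hv1
          exact ht' (ih' t ht (by simpa using ev))
        have hτ : ∀ g ∈ genGe n (i.1 + 1), phiAct k (tau i ^ m) g = g := by
          intro g hg
          suffices H : genGe n (i.1 + 1) ≤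
              (MonoidHom.eqLocus (phi n k (tau i ^ m)).1.unop.toMonoidHom (MonoidHom.id _)) from
            H hg
          rw [genGe, Subgroup.closure_le]
          rintro _ ⟨j, hj, rfl⟩
          refine phiAct_tau_zpow_of_ne k i m fun e => ?_
          have : i.1 + 1 ≤ j.1 := hj
          rw [e, lowIdx] at this
          simp at this
        -- The factor t turns the conjugator u into v⁻¹u', which τ_p^m fixes; τ_p^m then contributes
        -- x_{p+1}^{km} in front.
        refine ⟨_, .step (k * m) (mul_ne_zero hk hm) v⁻¹ (inv_mem hv) hv1 u' hu', ?_⟩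
        have h3 : v⁻¹ * u' ∈ genGe n (i.1 + 1) := eu ▸ phiAct_mem_genGe k hu.mem_genGe
        have h4 : phiAct k t (FreeGroup.of (lowIdx i)) = FreeGroup.of (lowIdx i) :=
          phiAct_of_lt k ht (Nat.lt_succ_self _)
        rw [phiAct_mul, phiAct_mul, e, phiAct_map_mul k t, phiAct_map_mul k t,
          phiAct_map_inv k t, eu, h4, phiAct_map_mul k (tau i ^ m) (_ * _),
          phiAct_map_mul k (tau i ^ m) _ (FreeGroup.of _), phiAct_map_inv k (tau i ^ m),
          hτ _ h3, phiAct_tau_zpow_low]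
        group
    rcases mem_tauGe_or_exists_tauReduced (p := i) ht with h | ⟨s, hs, h, hh, rfl⟩
    · exact h
    exfalso
    obtain ⟨u, hu, e⟩ := red s hs
    have hu1 : u ≠ 1 := hu.ne_one (genGe_toWord (Nat.lt_succ_self _))
    have h4 : phiAct k h (FreeGroup.of (lowIdx i)) = FreeGroup.of (lowIdx i) :=
      phiAct_of_lt k hh (Nat.lt_succ_self _)
    rw [phiAct_mul] at hfix
    have hfix' := phiAct_injective k h (hfix.trans h4.symm)
    rw [e] at hfix'
    have h5 : u ∈ genGe n (i.1 + 1) := hu.mem_genGe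
    exact hu1 (FreeGroup.eq_one_of_conj_eq (q := lowIdx i) (genGe_toWord (Nat.lt_succ_self _))
      h5 hfix')

theorem phi_injective {k : ℤ} (hk : k ≠ 0) : Function.Injective (phi n k) := by
  rw [← MonoidHom.ker_eq_bot_iff, eq_bot_iff]
  intro t ht
  have hfix : ∀ x, phiAct k t x = x := by
    intro x
    rw [phiAct, MonoidHom.mem_ker.1 ht]; rfl
  have hmem : ∀ p, p ≤ n → t ∈ tauGe n p := by
    intro p
    induction p with
    | zero =>
      intro _
      have : tauGe n 0 = ⊤ := by
        rw [← closure_range_tau, tauGe]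
        congr 1
        ext x
        simp
      rw [this]; trivial
    | succ p ih =>
      intro hp
      exact mem_tauGe_succ_of_phiAct_eq hk (n - p) ⟨p, hp⟩ (by simp only; omega) t
        (ih (by omega)) (hfix _)
  have hbot : tauGe n n ≤ ⊥ := by
    rw [tauGe, Subgroup.closure_le]
    rintro _ ⟨i, hi, rfl⟩
    have : n ≤ i.1 := hi
    omega
  exact hbot (hmem n le_rfl)

end Phi

/-! ### Ping-pong for T_n -/

section PingPong

variable {n : ℕ}

/-- The element of `T_n` spelled by a list of syllables. -/
def syllableProd (l : List (Fin (n - 1) × ℤ)) : TGroup n := (l.map fun p => tau p.1 ^ p.2).prod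

theorem syllableProd_append (l l' : List (Fin (n - 1) × ℤ)) :
    syllableProd (l ++ l') = syllableProd l * syllableProd l' := by
  simp [syllableProd]

theorem syllableProd_singleton (i : Fin (n - 1)) (m : ℤ) :
    syllableProd [(i, m)] = tau i ^ m := by
  simp [syllableProd]

theorem exists_syllableProd_eq (g : TGroup n) : ∃ l, syllableProd l = g := by
  induction g using TGroup.induction_zpow with
  | one => exact ⟨[], rfl⟩
  | mul g i m ih =>
    obtain ⟨l, rfl⟩ := ih
    exact ⟨l ++ [(i, m)], by rw [syllableProd_append, syllableProd_singleton]⟩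

/-- A list of syllables of minimal length among those spelling the same element. -/
def IsMinimalSyllables (l : List (Fin (n - 1) × ℤ)) : Prop :=
  ∀ l', syllableProd l' = syllableProd l → l.length ≤ l'.length

theorem exists_isMinimalSyllables (g : TGroup n) :
    ∃ l, IsMinimalSyllables l ∧ syllableProd l = g := by
  let s : Set (List (Fin (n - 1) × ℤ)) := {l | syllableProd l = g}
  obtain ⟨l, hl, hmin⟩ := (measure (List.length (α := Fin (n - 1) × ℤ))).wf.has_min s
    (exists_syllableProd_eq g)
  refine ⟨l, fun l' hl' => ?_, hl⟩
  exact not_lt.1 (hmin l' (hl'.trans hl))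

theorem IsMinimalSyllables.of_append_left {l l' : List (Fin (n - 1) × ℤ)}
    (h : IsMinimalSyllables (l ++ l')) : IsMinimalSyllables l := by
  intro l'' hl''
  have := h (l'' ++ l') (by rw [syllableProd_append, syllableProd_append, hl''])
  simpa using this

theorem IsMinimalSyllables.ne_zero {l : List (Fin (n - 1) × ℤ)} {i : Fin (n - 1)} {m : ℤ}
    (h : IsMinimalSyllables (l ++ [(i, m)])) : m ≠ 0 := by
  rintro rfl
  have := h l (by rw [syllableProd_append, syllableProd_singleton]; simp)
  simp at this

/-- A ping-pong criterion for the nontrivial elements of `T_n`. -/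
theorem TGroup.exists_mem_of_pingPong {X : Type} (f : TGroup n → X → X)
    (hmul : ∀ g h x, f (g * h) x = f h (f g x)) (S : Fin (n - 1) → Set X) (x₀ : X)
    (h0 : ∀ i (m : ℤ), m ≠ 0 → f (tau i ^ m) x₀ ∈ S i)
    (hadj : ∀ i j : Fin (n - 1), i.1 = j.1 + 1 ∨ j.1 = i.1 + 1 → ∀ m : ℤ, m ≠ 0 →
      ∀ x ∈ S j, f (tau i ^ m) x ∈ S i)
    (hfar : ∀ i j : Fin (n - 1), 1 < |((i : ℕ) : ℤ) - ((j : ℕ) : ℤ)| → ∀ m : ℤ,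
      ∀ x ∈ S j, f (tau i ^ m) x ∈ S j)
    {g : TGroup n} (hg : g ≠ 1) : ∃ i, f g x₀ ∈ S i := by
  -- A minimal spelling sends the base point into the set of its last syllable, whichever last
  -- syllable the spelling has.
  have key : ∀ N : ℕ, ∀ l : List (Fin (n - 1) × ℤ), l.length = N → ∀ i m,
      IsMinimalSyllables (l ++ [(i, m)]) → f (syllableProd (l ++ [(i, m)])) x₀ ∈ S i := by
    intro N
    induction N with
    | zero =>
      intro l hl i m hmin
      obtain rfl := List.length_eq_zero_iff.1 hl
      rw [List.nil_append, syllableProd_singleton]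
      exact h0 i m hmin.ne_zero
    | succ N ih =>
      intro l hl i m hmin
      obtain ⟨l, ⟨j, p⟩, rfl⟩ : ∃ l' q, l = l' ++ [q] :=
        ⟨_, _, (List.dropLast_append_getLast (l := l) (by rintro rfl; simp at hl)).symm⟩
      have hl' : l.length = N := by simpa using hl
      by_cases hij : i = j
      · subst hij
        -- Two equal neighbouring indices would merge, against minimality.
        have := hmin (l ++ [(i, p + m)]) (by
          simp only [syllableProd_append, syllableProd_singleton, zpow_add, mul_assoc])
        simp at this
      by_cases hd : i.1 = j.1 + 1 ∨ j.1 = i.1 + 1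
      · rw [syllableProd_append _ [(i, m)], syllableProd_singleton, hmul]
        exact hadj i j hd m hmin.ne_zero _ (ih l hl' j p hmin.of_append_left)
      · have hd' : 1 < |((j : ℕ) : ℤ) - ((i : ℕ) : ℤ)| := by
          rw [lt_abs]
          have := fun h => hij (Fin.ext h)
          omega
        -- Distant last syllables are swapped: the shorter word ending in i reaches S i, and the
        -- syllable at j, now applied last, preserves S i.
        have e : syllableProd (l ++ [(j, p)] ++ [(i, m)]) =
            syllableProd (l ++ [(i, m)] ++ [(j, p)]) := by
          simp only [syllableProd_append, syllableProd_singleton, mul_assoc]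
          rw [((tau_commute hd').zpow_zpow p m).eq]
        have hmin' : IsMinimalSyllables (l ++ [(i, m)] ++ [(j, p)]) := by
          intro l'' hl''
          simpa using hmin l'' (hl''.trans e.symm)
        rw [e, syllableProd_append _ [(j, p)], syllableProd_singleton, hmul]
        exact hfar j i hd' p _ (ih l hl' i m hmin'.of_append_left)
  obtain ⟨l, hmin, rfl⟩ := exists_isMinimalSyllables g
  obtain ⟨l, ⟨i, m⟩, rfl⟩ : ∃ l' q, l = l' ++ [q] :=
    ⟨_, _, (List.dropLast_append_getLast (l := l) (by rintro rfl; exact hg rfl)).symm⟩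
  exact ⟨i, key _ l rfl i m hmin⟩

end PingPong

/-! ### Last letters and power maps in free groups -/

section Words

variable {α : Type}

/-- A letter of a word as an element of the free group. -/
def FreeGroup.letter (p : α × Bool) : FreeGroup α := FreeGroup.mk [p]

theorem FreeGroup.letter_eq (p : α × Bool) :
    FreeGroup.letter p = FreeGroup.of p.1 ^ (if p.2 then (1 : ℤ) else -1) := by
  obtain ⟨a, b | b⟩ := p
  · simp [FreeGroup.letter, FreeGroup.of, FreeGroup.invRev]
  · simp [FreeGroup.letter, FreeGroup.of]

/-- The homomorphism raising all free generators to the `k`-th power. -/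
def FreeGroup.powerMap (α : Type) (k : ℤ) : FreeGroup α →* FreeGroup α :=
  FreeGroup.lift fun a => FreeGroup.of a ^ k

theorem FreeGroup.powerMap_of (k : ℤ) (a : α) :
    FreeGroup.powerMap α k (FreeGroup.of a) = FreeGroup.of a ^ k :=
  FreeGroup.lift_apply_of

variable [DecidableEq α]

theorem FreeGroup.toWord_letter (p : α × Bool) : (FreeGroup.letter p).toWord = [p] := by
  rw [FreeGroup.letter, FreeGroup.toWord_mk]
  rfl

/-- The last letter of the reduced word of `w` is `p`. -/
def FreeGroup.EndsIn (w : FreeGroup α) (p : α × Bool) : Prop := w.toWord.getLast? = some p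

theorem FreeGroup.EndsIn.mul {w u : FreeGroup α} {p q : α × Bool} (hw : w.EndsIn p)
    (hu : u.EndsIn q) (h : ∀ a ∈ u.toWord.head?, p.1 = a.1 → p.2 = a.2) : (w * u).EndsIn q := by
  have h1 : u.toWord ≠ [] := by
    intro h1
    simp [FreeGroup.EndsIn, h1] at hu
  rw [FreeGroup.EndsIn, FreeGroup.toWord_mul_of_reduced,
    List.getLast?_append_of_ne_nil _ h1]
  · exact hu
  · intro a ha b hb
    obtain rfl : p = a := Option.some_inj.1 (hw.symm.trans ha)
    exact h b hb

theorem FreeGroup.endsIn_zpow {c : α} {e : ℤ} (he : e ≠ 0) :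
    (FreeGroup.of c ^ e).EndsIn (c, decide (0 < e)) := by
  rw [FreeGroup.EndsIn, FreeGroup.toWord_of_zpow, List.getLast?_replicate,
    if_neg (Int.natAbs_ne_zero.2 he)]

theorem FreeGroup.head?_zpow {c : α} {e : ℤ} :
    ∀ a ∈ (FreeGroup.of c ^ e).toWord.head?, a = (c, decide (0 < e)) := by
  intro a ha
  rw [FreeGroup.toWord_of_zpow] at ha
  exact List.eq_of_mem_replicate (List.mem_of_head? ha)

theorem FreeGroup.EndsIn.mul_zpow {w : FreeGroup α} {p : α × Bool} (hw : w.EndsIn p) {c : α}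
    (hp : p.1 ≠ c) {e : ℤ} (he : e ≠ 0) :
    (w * FreeGroup.of c ^ e).EndsIn (c, decide (0 < e)) := by
  refine hw.mul (FreeGroup.endsIn_zpow he) fun a ha h => ?_
  rw [FreeGroup.head?_zpow a ha] at h
  exact absurd h hp

theorem FreeGroup.powerMap_injective {k : ℤ} (hk : k ≠ 0) :
    Function.Injective (FreeGroup.powerMap α k) := by
  -- The first letter of the image is determined by that of L, because blocks of k-th powers of
  -- consecutive letters do not cancel.
  have key : ∀ L : List (α × Bool), FreeGroup.IsReduced L → ∀ p ∈ L.head?,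
      (FreeGroup.powerMap α k (FreeGroup.mk L)).toWord.head? =
        some (p.1, decide (0 < if p.2 then k else -k)) := by
    intro L
    induction L with
    | nil => intro _ p hp; simp at hp
    | cons p L ih =>
      intro hL q hq
      obtain rfl : p = q := by simpa using hq
      have e : FreeGroup.mk (p :: L) = FreeGroup.letter p * FreeGroup.mk L := by
        rw [FreeGroup.letter, FreeGroup.mul_mk]; rfl
      have e2 : FreeGroup.powerMap α k (FreeGroup.letter p) =
          FreeGroup.of p.1 ^ (if p.2 then k else -k) := by
        rw [FreeGroup.letter_eq, map_zpow, FreeGroup.powerMap_of, ← zpow_mul]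
        split_ifs <;> simp
      have h0 : (if p.2 then k else -k) ≠ 0 := by split_ifs <;> simpa
      rw [e, _root_.map_mul, e2, FreeGroup.toWord_mul_of_reduced, FreeGroup.toWord_of_zpow]
      · obtain ⟨m, hm⟩ := Nat.exists_eq_succ_of_ne_zero (Int.natAbs_ne_zero.2 h0)
        rw [hm, List.replicate_succ]
        rfl
      · intro a ha b hb hab
        obtain rfl := Option.some_inj.1 ((FreeGroup.endsIn_zpow h0).symm.trans ha)
        rcases L with _ | ⟨q, L⟩
        · rw [← FreeGroup.one_eq_mk, _root_.map_one] at hb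
          simp at hb
        · have h1 := FreeGroup.isReduced_cons_cons.1 hL
          have h2 := ih h1.2 q rfl
          obtain rfl := Option.some_inj.1 (h2.symm.trans hb)
          simp only at hab ⊢
          rw [h1.1 hab]
  rw [← MonoidHom.ker_eq_bot_iff, eq_bot_iff]
  intro x hx
  rw [MonoidHom.mem_ker] at hx
  rw [Subgroup.mem_bot, ← FreeGroup.toWord_eq_nil_iff]
  by_contra h
  obtain ⟨p, L, hL⟩ := List.exists_cons_of_ne_nil h
  have := key x.toWord FreeGroup.isReduced_toWord p (by rw [hL]; rfl)
  rw [FreeGroup.mk_toWord, hx] at this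
  simp at this

end Words

/-! ### Transvections and words containing squares -/

section Transvection

/-- The exponent of `y_c` that a transvection with parameter `m` puts before `y_l`. -/
def leftShift (c : ℕ) (m : ℤ) (l : ℕ) : ℤ := if l = c + 1 then m else 0

/-- The exponent of `y_c` that a transvection with parameter `m` puts after `y_l`. -/
def rightShift (c : ℕ) (m : ℤ) (l : ℕ) : ℤ := if l + 1 = c then -m else 0

/-- The endomorphism `y_{c-1} ↦ y_{c-1} y_c^{-m}`, `y_{c+1} ↦ y_c^m y_{c+1}` of the free group
on `y_0, y_1, …`, which fixes the other generators. -/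
def transvectionHom (c : ℕ) (m : ℤ) : FreeGroup ℕ →* FreeGroup ℕ :=
  FreeGroup.lift fun l => FreeGroup.of c ^ leftShift c m l * FreeGroup.of l *
    FreeGroup.of c ^ rightShift c m l

theorem transvectionHom_of (c : ℕ) (m : ℤ) (l : ℕ) :
    transvectionHom c m (FreeGroup.of l) = FreeGroup.of c ^ leftShift c m l * FreeGroup.of l *
      FreeGroup.of c ^ rightShift c m l :=
  FreeGroup.lift_apply_of

theorem transvectionHom_self (c : ℕ) (m : ℤ) :
    transvectionHom c m (FreeGroup.of c) = FreeGroup.of c := by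
  simp [transvectionHom_of, leftShift, rightShift]

theorem leftShift_add (c : ℕ) (m m' : ℤ) (l : ℕ) :
    leftShift c (m + m') l = leftShift c m l + leftShift c m' l := by
  unfold leftShift; split_ifs <;> simp

theorem rightShift_add (c : ℕ) (m m' : ℤ) (l : ℕ) :
    rightShift c (m + m') l = rightShift c m l + rightShift c m' l := by
  unfold rightShift; split_ifs <;> ring

theorem transvectionHom_comp (c : ℕ) (m m' : ℤ) :
    (transvectionHom c m).comp (transvectionHom c m') = transvectionHom c (m + m') := by
  ext l
  rw [MonoidHom.comp_apply, transvectionHom_of, transvectionHom_of, map_mul, map_mul, map_zpow,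
    map_zpow, transvectionHom_self, transvectionHom_of, add_comm m, leftShift_add, add_comm m',
    rightShift_add, zpow_add, zpow_add, zpow_mul_comm]
  group

theorem transvectionHom_zero (c : ℕ) : transvectionHom c 0 = MonoidHom.id _ := by
  ext l
  simp [transvectionHom_of, leftShift, rightShift]

/-- The transvections as automorphisms. -/
def transvection (c : ℕ) (m : ℤ) : MulAut (FreeGroup ℕ) :=
  MonoidHom.toMulEquiv (transvectionHom c m) (transvectionHom c (-m))
    (by rw [transvectionHom_comp, neg_add_cancel, transvectionHom_zero])
    (by rw [transvectionHom_comp, add_neg_cancel, transvectionHom_zero])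

theorem transvection_apply (c : ℕ) (m : ℤ) (x : FreeGroup ℕ) :
    transvection c m x = transvectionHom c m x := rfl

theorem transvection_add (c : ℕ) (m m' : ℤ) :
    transvection c (m + m') = transvection c m * transvection c m' := by
  apply MulEquiv.toMonoidHom_injective
  exact (transvectionHom_comp c m m').symm

theorem transvection_zpow (c : ℕ) (m k : ℤ) : transvection c m ^ k = transvection c (m * k) := by
  let f : Multiplicative ℤ →* MulAut (FreeGroup ℕ) :=
    { toFun := fun z => transvection c z.toAdd
      map_one' := by
        apply MulEquiv.toMonoidHom_injective
        exact transvectionHom_zero c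
      map_mul' := fun a b => transvection_add c _ _ }
  have := map_zpow f (Multiplicative.ofAdd m) k
  rw [mul_comm, ← smul_eq_mul]
  exact this.symm

theorem transvectionHom_of_ne (c d : ℕ) (m : ℤ) (h1 : d ≠ c + 1) (h2 : d + 1 ≠ c) :
    transvectionHom c m (FreeGroup.of d) = FreeGroup.of d := by
  simp [transvectionHom_of, leftShift, rightShift, h1, h2]

/-- Even for d = c + 2 there is no interference: the shared neighbour y_{c+1} gets a power of y_c on
its left and a power of y_d on its right. -/
theorem transvection_commute {c d : ℕ} (m m' : ℤ) (h1 : d ≠ c + 1) (h2 : d + 1 ≠ c) :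
    Commute (transvection c m) (transvection d m') := by
  by_cases hcd : c = d
  · subst hcd
    unfold Commute SemiconjBy
    rw [← transvection_add, ← transvection_add, add_comm]
  apply MulEquiv.toMonoidHom_injective
  ext l
  change transvectionHom c m (transvectionHom d m' (FreeGroup.of l)) =
    transvectionHom d m' (transvectionHom c m (FreeGroup.of l))
  rw [transvectionHom_of, transvectionHom_of]
  simp only [map_mul, map_zpow, transvectionHom_of_ne c d m h1 h2,
    transvectionHom_of_ne d c m' (Ne.symm h2) (Ne.symm h1)]
  rw [transvectionHom_of, transvectionHom_of]
  unfold leftShift rightShift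
  split_ifs <;> first
    | omega
    | simp [mul_assoc]

/-- The shift of the exponent of `y_c` after the letter `p` under a transvection. -/
def letterShift (c : ℕ) (m : ℤ) (p : ℕ × Bool) : ℤ :=
  if p.2 then rightShift c m p.1 else -leftShift c m p.1

theorem transvectionHom_letter (c : ℕ) (m : ℤ) (p : ℕ × Bool) :
    transvectionHom c m (FreeGroup.letter p) =
      FreeGroup.of c ^ (-letterShift c m (p.1, !p.2)) * FreeGroup.letter p *
        FreeGroup.of c ^ letterShift c m p := by
  rw [FreeGroup.letter_eq, map_zpow, transvectionHom_of]
  obtain ⟨l, b | b⟩ := p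
  · simp [letterShift, mul_assoc]
  · simp [letterShift]

open FreeGroup in
/-- `SpacedWord c w o` holds if `w` is a product of letters other than `y_c^{±1}` and powers of
`y_c` between them, without cancellation, ending in the letter `o` (or empty). -/
inductive SpacedWord (c : ℕ) : FreeGroup ℕ → Option (ℕ × Bool) → Prop
  | one : SpacedWord c 1 none
  | snoc (w : FreeGroup ℕ) (o : Option (ℕ × Bool)) (hw : SpacedWord c w o) (q : ℤ)
      (p : ℕ × Bool) (hp : p.1 ≠ c) (h : q = 0 → ∀ p' ∈ o, p'.1 = p.1 → p'.2 = p.2) :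
      SpacedWord c (w * of c ^ q * letter p) (some p)

theorem SpacedWord.endsIn {c : ℕ} {w : FreeGroup ℕ} {o : Option (ℕ × Bool)}
    (hw : SpacedWord c w o) : w.toWord.getLast? = o ∧ ∀ p ∈ o, p.1 ≠ c := by
  induction hw with
  | one => simp
  | snoc w o hw q p hp h ih =>
    refine ⟨?_, by rintro _ ⟨⟩; exact hp⟩
    have hl : (FreeGroup.letter p).EndsIn p := by
      rw [FreeGroup.EndsIn, FreeGroup.toWord_letter]; rfl
    have hh : ∀ a ∈ (FreeGroup.letter p).toWord.head?, a = p := by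
      intro a ha
      rw [FreeGroup.toWord_letter] at ha
      exact (Option.some_inj.1 ha).symm
    by_cases hq : q = 0
    · rw [hq, zpow_zero, mul_one]
      rcases o with _ | p'
      · have : w = 1 := by simpa using ih.1
        rw [this, one_mul]; exact hl
      · exact FreeGroup.EndsIn.mul (p := p') ih.1 hl fun a ha e => by
          rw [hh a ha] at e ⊢
          exact h hq p' rfl e
    · have h1 : (w * FreeGroup.of c ^ q).EndsIn (c, decide (0 < q)) := by
        rcases o with _ | p'
        · have : w = 1 := by simpa using ih.1
          rw [this, one_mul]; exact FreeGroup.endsIn_zpow hq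
        · exact FreeGroup.EndsIn.mul_zpow (p := p') ih.1 (ih.2 p' rfl) hq
      exact h1.mul hl fun a ha e => by
        rw [hh a ha] at e
        exact absurd e.symm hp

theorem exists_spacedWord (c : ℕ) (L : List (ℕ × Bool)) (hL : FreeGroup.IsReduced L) :
    ∃ w o, ∃ q : ℤ, SpacedWord c w o ∧ FreeGroup.mk L = w * FreeGroup.of c ^ q ∧
      (q = 0 → L.getLast? = o) ∧ (q ≠ 0 → L.getLast? = some (c, decide (0 < q))) := by
  induction L using List.reverseRecOn with
  | nil => exact ⟨1, none, 0, .one, by simp [FreeGroup.one_eq_mk], by simp, by simp⟩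
  | append_singleton L p ih =>
    have hL' := List.isChain_append.1 hL
    obtain ⟨w, o, q, hw, e, h0, h1⟩ := ih hL'.1
    have e' : FreeGroup.mk (L ++ [p]) = FreeGroup.mk L * FreeGroup.letter p := by
      rw [FreeGroup.letter, FreeGroup.mul_mk]
    have hlast : ∀ x ∈ L.getLast?, x.1 = p.1 → x.2 = p.2 := fun x hx => hL'.2.2 x hx p rfl
    by_cases hp : p.1 = c
    -- By reducedness the new letter y_c^{±1} has the sign of the current trailing power, so the
    -- exponent moves away from zero.
    · have hq : q ≠ 0 → decide (0 < q) = p.2 := fun hq => hlast _ (h1 hq) hp.symm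
      have hs : q + (if p.2 then 1 else -1) ≠ 0 ∧
          decide (0 < q + (if p.2 then 1 else -1)) = p.2 := by
        by_cases hq0 : q = 0
        · subst hq0
          rcases p.2 <;> simp
        · have := hq hq0
          revert this
          rcases p.2 <;> intro this
          · rw [decide_eq_false_iff_not] at this ⊢
            simp only [Bool.false_eq_true, if_false]
            omega
          · rw [decide_eq_true_eq] at this ⊢
            simp only [if_true]
            omega
      refine ⟨w, o, q + (if p.2 then 1 else -1), hw, ?_, fun h => absurd h hs.1, fun _ => ?_⟩
      · rw [e', e, FreeGroup.letter_eq, hp, mul_assoc, ← zpow_add]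
      · rw [hs.2, ← hp]; simp
    · refine ⟨_, some p, 0, .snoc w o hw q p hp ?_, ?_, by simp, by simp⟩
      · intro hq p' hp'
        exact hlast p' (by rw [h0 hq]; exact hp')
      · rw [e', e, zpow_zero, mul_one]

theorem SpacedWord.of_endsIn {c : ℕ} {w : FreeGroup ℕ} {p : ℕ × Bool} (hw : w.EndsIn p)
    (hp : p.1 ≠ c) : SpacedWord c w (some p) := by
  obtain ⟨u, o, q, hu, e, h0, h1⟩ := exists_spacedWord c w.toWord FreeGroup.isReduced_toWord
  have hq : q = 0 := by
    by_contra hq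
    have := hw.symm.trans (h1 hq)
    exact hp (congrArg Prod.fst (Option.some_inj.1 this))
  rw [FreeGroup.mk_toWord, hq, zpow_zero, mul_one] at e
  rw [e, ← hw, h0 hq]
  exact hu

/-- A transvection keeps the letters other than y_c^{±1} and only shifts the exponents of y_c
between them. The correcting factor removes the power produced after the last letter. -/
theorem SpacedWord.transvection {c : ℕ} (m : ℤ) {w : FreeGroup ℕ} {o : Option (ℕ × Bool)}
    (hw : SpacedWord c w o) : SpacedWord c (transvectionHom c m w *
      FreeGroup.of c ^ (-(o.elim 0 (letterShift c m)))) o := by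
  induction hw with
  | one => simpa using SpacedWord.one
  | snoc w o hw q p hp h ih =>
    have := SpacedWord.snoc _ o ih (o.elim 0 (letterShift c m) + q - letterShift c m (p.1, !p.2))
      p hp (by
        -- For mutually inverse neighbours p', p the two shifts cancel. The exponent between them is
        -- then the old q, so it vanishes only if q did, which the hypothesis on the old word
        -- excludes.
        intro hq p' hp' e
        by_contra hne
        have e2 : p' = (p.1, !p.2) := by
          refine Prod.ext e ?_
          revert hne; rcases p'.2 <;> rcases p.2 <;> simp
        obtain rfl : o = some p' := hp'
        subst e2
        simp only [Option.elim_some] at hq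
        exact hne (h (by linarith) _ rfl e))
    convert this using 1
    rw [map_mul, map_mul, map_zpow, transvectionHom_self, transvectionHom_letter]
    simp only [Option.elim_some]
    group

theorem FreeGroup.EndsIn.transvection {c : ℕ} (m : ℤ) {w : FreeGroup ℕ} {p : ℕ × Bool}
    (hw : w.EndsIn p) (hp : p.1 ≠ c) :
    (transvectionHom c m w * FreeGroup.of c ^ (-letterShift c m p)).EndsIn p :=
  ((SpacedWord.of_endsIn hw hp).transvection m).endsIn.1

/-- The words whose reduced form contains a square `y_c^{±2}`. -/
def squareWords (c : ℕ) : Set (FreeGroup ℕ) :=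
  {w | ∃ b u v, u.EndsIn (c, b) ∧ v.EndsIn (c, !b) ∧ w = u * v⁻¹}

/-- The word is cut after the first letter of y_c^e; the remaining letters have the same sign and,
inverted, go to v. -/
theorem mem_squareWords_of_endsIn {c : ℕ} {u v : FreeGroup ℕ} {p q : ℕ × Bool}
    (hu : u.EndsIn p) (hp : p.1 ≠ c) (hv : v.EndsIn q) (hq : q.1 ≠ c) {e : ℤ} (he : 1 < |e|) :
    u * FreeGroup.of c ^ e * v⁻¹ ∈ squareWords c := by
  rcases lt_abs.1 he with he | he
  · refine ⟨_, _, v * FreeGroup.of c ^ (1 - e), hu.mul_zpow hp one_ne_zero, ?_, ?_⟩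
    · convert hv.mul_zpow hq (e := 1 - e) (by omega) using 2
      simp; omega
    · group
  · refine ⟨_, _, v * FreeGroup.of c ^ (-1 - e), hu.mul_zpow hp (e := -1) (by simp), ?_, ?_⟩
    · convert hv.mul_zpow hq (e := -1 - e) (by omega) using 2
      simp; omega
    · group

/-- Isolates the power of y_c at the junction. With p and q the last letters of u and v, the outer
factors keep those last letters when they are not powers of y_c. -/
theorem transvectionHom_mul_inv (c : ℕ) (m : ℤ) (u v : FreeGroup ℕ) (p q : ℕ × Bool) :
    transvectionHom c m (u * v⁻¹) =
      (transvectionHom c m u * FreeGroup.of c ^ (-letterShift c m p)) *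
        FreeGroup.of c ^ (letterShift c m p - letterShift c m q) *
        (transvectionHom c m v * FreeGroup.of c ^ (-letterShift c m q))⁻¹ := by
  rw [map_mul, map_inv]
  group

/-- Exactly one of y_d, y_d^{-1} acquires a power of y_c behind it, namely y_c^{-m}. Hence y_c^{±m}
is inserted inside the square of y_d. -/
theorem transvectionHom_mem_squareWords {c d : ℕ} (h : c = d + 1 ∨ d = c + 1) {m : ℤ}
    (hm : 1 < |m|) {w : FreeGroup ℕ} (hw : w ∈ squareWords d) :
    transvectionHom c m w ∈ squareWords c := by
  obtain ⟨b, u, v, hu, hv, rfl⟩ := hw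
  rw [transvectionHom_mul_inv c m u v (d, b) (d, !b)]
  have hdc : d ≠ c := by omega
  refine mem_squareWords_of_endsIn (hu.transvection m hdc) hdc (hv.transvection m hdc) hdc ?_
  have h1 : ∀ d : ℕ, d ≠ d + 1 + 1 := by omega
  rcases h with rfl | rfl <;> rcases b <;>
    simpa [letterShift, leftShift, rightShift, h1, (h1 _).symm]

theorem transvectionHom_mem_squareWords_of_ne {c d : ℕ} (h0 : d ≠ c) (h1 : d ≠ c + 1)
    (h2 : d + 1 ≠ c) (m : ℤ) {w : FreeGroup ℕ} (hw : w ∈ squareWords d) :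
    transvectionHom c m w ∈ squareWords d := by
  obtain ⟨b, u, v, hu, hv, rfl⟩ := hw
  have hu' := hu.transvection m h0
  have hv' := hv.transvection m h0
  simp only [letterShift, leftShift, rightShift, h1, h2, if_false, neg_zero, ite_self,
    zpow_zero, mul_one] at hu' hv'
  exact ⟨b, _, _, hu', hv', by rw [map_mul, map_inv]⟩

/-- The word `y_0 y_2^{-1} y_1 y_3^{-1} ⋯ y_{k-1} y_{k+1}^{-1}`. -/
def baseWord (k : ℕ) : List (ℕ × Bool) :=
  (List.range k).flatMap fun i => [(i, true), (i + 2, false)]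

theorem baseWord_succ (k : ℕ) : baseWord (k + 1) = baseWord k ++ [(k, true), (k + 2, false)] := by
  simp [baseWord, List.range_succ]

theorem baseWord_isChain (k : ℕ) : (baseWord k).IsChain (fun a b => a.1 ≠ b.1) ∧
    ∀ a ∈ (baseWord k).getLast?, a.1 = k + 1 := by
  induction k with
  | zero => simp [baseWord]
  | succ k ih =>
    rw [baseWord_succ]
    refine ⟨List.isChain_append.2 ⟨ih.1, by simp, ?_⟩, by simp⟩
    intro a ha b hb
    have h1 := ih.2 a ha
    simp only [List.head?_cons, Option.mem_some_iff] at hb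
    subst hb
    simp only
    omega

theorem baseWord_isReduced (k : ℕ) : FreeGroup.IsReduced (baseWord k) :=
  (baseWord_isChain k).1.imp fun _ _ h e => absurd e h

theorem exists_baseWord_eq {k i : ℕ} (h : i < k) :
    ∃ A B, baseWord k = A ++ [(i, true), (i + 2, false)] ++ B := by
  obtain ⟨s, t, e⟩ := List.append_of_mem (List.mem_range.2 h)
  refine ⟨s.flatMap fun i => [(i, true), (i + 2, false)],
    t.flatMap fun i => [(i, true), (i + 2, false)], ?_⟩
  rw [baseWord, e]
  simp

/-- Consecutive letters of the base word have different indices. -/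
theorem mk_baseWord_not_mem_squareWords (k c : ℕ) : FreeGroup.mk (baseWord k) ∉ squareWords c := by
  rintro ⟨b, u, v, hu, hv, e⟩
  have hv' : (v⁻¹).toWord.head? = some (c, b) := by
    rw [FreeGroup.toWord_inv, FreeGroup.invRev, List.head?_reverse, List.getLast?_map, hv]
    simp
  have h1 : baseWord k = u.toWord ++ (v⁻¹).toWord := by
    rw [← FreeGroup.toWord_mul_of_reduced, ← e, FreeGroup.toWord_mk,
      (baseWord_isReduced k).reduce_eq]
    intro a ha a' ha' _
    obtain rfl := Option.some_inj.1 (hu.symm.trans ha)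
    obtain rfl := Option.some_inj.1 (hv'.symm.trans ha')
    rfl
  have h2 := (baseWord_isChain k).1
  rw [h1] at h2
  exact (List.isChain_append.1 h2).2.2 _ hu _ hv' rfl

theorem transvectionHom_baseWord_mem {k i : ℕ} (h : i < k) {m : ℤ} (hm : 1 < |m|) :
    transvectionHom (i + 1) m (FreeGroup.mk (baseWord k)) ∈ squareWords (i + 1) := by
  obtain ⟨A, B, e⟩ := exists_baseWord_eq h
  have hred := baseWord_isReduced k
  have e1 : baseWord k = (A ++ [(i, true)]) ++ ((i + 2, false) :: B) := by rw [e]; simp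
  rw [e1] at hred ⊢
  have h1 := (List.isChain_append.1 hred).1
  have h2 := (List.isChain_append.1 hred).2.1
  set u := FreeGroup.mk (A ++ [(i, true)]) with hu
  set v := (FreeGroup.mk ((i + 2, false) :: B))⁻¹ with hv
  have hue : u.EndsIn (i, true) := by
    rw [FreeGroup.EndsIn, hu, FreeGroup.toWord_mk, FreeGroup.IsReduced.reduce_eq h1]
    simp
  have hve : v.EndsIn (i + 2, true) := by
    rw [FreeGroup.EndsIn, hv, FreeGroup.toWord_inv, FreeGroup.toWord_mk,
      FreeGroup.IsReduced.reduce_eq h2]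
    simp [FreeGroup.invRev]
  have e2 : FreeGroup.mk ((A ++ [(i, true)]) ++ ((i + 2, false) :: B)) = u * v⁻¹ := by
    rw [hv, inv_inv, hu, FreeGroup.mul_mk]
  -- The cut lies between y_i and y_{i+2}^{-1}: y_i puts y_{i+1}^{-m} there and y_{i+2}^{-1} puts
  -- nothing.
  rw [e2, transvectionHom_mul_inv _ m u v (i, true) (i + 2, true)]
  refine mem_squareWords_of_endsIn (hue.transvection m ?_) ?_ (hve.transvection m ?_) ?_ ?_
  all_goals simp [letterShift, rightShift, hm]

end Transvection

/-! ### Faithfulness of ψ_{k,k} through involutions -/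

section Psi

variable {n : ℕ}

theorem psi_tau (k l : ℤ) (i : Fin (n - 1)) :
    psi n k l (tau i) = eps (lowIdx i) (highIdx i) (lowIdx_ne_highIdx i) ^ k *
      eps (highIdx i) (lowIdx i) (lowIdx_ne_highIdx i).symm ^ l :=
  TGroup.lift_tau _ _ i

theorem psi_tau_act (k l : ℤ) (i : Fin (n - 1)) (x : FreeGroup (Fin n)) :
    (psi n k l (tau i)).1.act x =
      (epsAut (highIdx i) (lowIdx i) (lowIdx_ne_highIdx i).symm ^ l)
        ((epsAut (lowIdx i) (highIdx i) (lowIdx_ne_highIdx i) ^ k) x) := by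
  rw [psi_tau, Subgroup.coe_mul, RAut.act_mul, eps_zpow_act, eps_zpow_act]

theorem psi_tau_act_low (k : ℤ) (i : Fin (n - 1)) :
    (psi n k k (tau i)).1.act (FreeGroup.of (lowIdx i)) =
      FreeGroup.of (lowIdx i) ^ (-k) * FreeGroup.of (highIdx i) ^ (-k) *
        FreeGroup.of (lowIdx i) * FreeGroup.of (highIdx i) ^ k *
        FreeGroup.of (lowIdx i) ^ k := by
  rw [psi_tau_act, epsAut_zpow_of_self, map_mul, map_mul, map_zpow, map_zpow,
    epsAut_zpow_of_self, epsAut_zpow_of_ne _ _ _ _ (lowIdx_ne_highIdx i)]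
  have hz : ∀ (x y : FreeGroup (Fin n)) (a : ℤ),
      (x ^ (-k) * y * x ^ k) ^ a = x ^ (-k) * y ^ a * x ^ k := by
    intro x y a
    simpa using conj_zpow (i := a) (a := x ^ (-k)) (b := y)
  rw [hz, hz]
  group

theorem psi_tau_act_high (k : ℤ) (i : Fin (n - 1)) :
    (psi n k k (tau i)).1.act (FreeGroup.of (highIdx i)) =
      FreeGroup.of (lowIdx i) ^ (-k) * FreeGroup.of (highIdx i) *
        FreeGroup.of (lowIdx i) ^ k := by
  rw [psi_tau_act, epsAut_zpow_of_ne _ _ _ _ (lowIdx_ne_highIdx i).symm, epsAut_zpow_of_self]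

theorem psi_tau_act_of_ne (k : ℤ) (i : Fin (n - 1)) {j : Fin n} (h1 : j ≠ lowIdx i)
    (h2 : j ≠ highIdx i) : (psi n k k (tau i)).1.act (FreeGroup.of j) = FreeGroup.of j := by
  rw [psi_tau_act, epsAut_zpow_of_ne _ _ _ _ h1, epsAut_zpow_of_ne _ _ _ _ h2]

/-- Powers of the generators intertwine `ψ_{1,1}` and `ψ_{k,k}`. -/
theorem powerMap_psi_act (k : ℤ) (t : TGroup n) (x : FreeGroup (Fin n)) :
    FreeGroup.powerMap _ k ((psi n 1 1 t).1.act x) =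
      (psi n k k t).1.act (FreeGroup.powerMap _ k x) := by
  have ht : t ∈ Subgroup.closure (Set.range (tau : Fin (n - 1) → TGroup n)) := by
    rw [closure_range_tau]; trivial
  induction ht using Subgroup.closure_induction generalizing x with
  | mem t ht =>
    obtain ⟨i, rfl⟩ := ht
    have h : (FreeGroup.powerMap (Fin n) k).comp (psi n 1 1 (tau i)).1.unop.toMonoidHom =
        (psi n k k (tau i)).1.unop.toMonoidHom.comp (FreeGroup.powerMap (Fin n) k) := by
      ext j
      change FreeGroup.powerMap _ k ((psi n 1 1 (tau i)).1.act (FreeGroup.of j)) =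
        (psi n k k (tau i)).1.act (FreeGroup.powerMap _ k (FreeGroup.of j))
      rw [FreeGroup.powerMap_of, RAut.act_map_zpow]
      by_cases h1 : j = lowIdx i
      · subst h1
        rw [psi_tau_act_low, psi_tau_act_low]
        simp only [map_mul, map_zpow, FreeGroup.powerMap_of]
        have := conj_zpow (i := k) (a := FreeGroup.of (lowIdx i) ^ (-k) *
          FreeGroup.of (highIdx i) ^ (-k)) (b := FreeGroup.of (lowIdx i))
        simp only [mul_inv_rev, ← zpow_neg, neg_neg] at this
        simp only [← mul_assoc] at this
        rw [this]
        group
      · by_cases h2 : j = highIdx i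
        · subst h2
          rw [psi_tau_act_high, psi_tau_act_high]
          simp only [map_mul, map_zpow, FreeGroup.powerMap_of]
          have := conj_zpow (i := k) (a := FreeGroup.of (lowIdx i) ^ (-k))
            (b := FreeGroup.of (highIdx i))
          simp only [← zpow_neg, neg_neg] at this
          rw [this]
          group
        · rw [psi_tau_act_of_ne _ _ h1 h2, psi_tau_act_of_ne _ _ h1 h2, FreeGroup.powerMap_of]
    exact DFunLike.congr_fun h x
  | one => simp only [map_one]; rfl
  | mul s t hs ht ihs iht =>
    rw [map_mul, map_mul, Subgroup.coe_mul, Subgroup.coe_mul, RAut.act_mul, RAut.act_mul, iht, ihs]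
  | inv t ht ih =>
    apply (psi n k k t).1.unop.injective
    change (psi n k k t).1.act _ = (psi n k k t).1.act _
    rw [← ih, ← RAut.act_mul, ← RAut.act_mul, ← Subgroup.coe_mul, ← Subgroup.coe_mul, ← map_mul,
      ← map_mul, inv_mul_cancel, map_one, map_one]
    rfl

/-- The action of `T_n` on a free group by transvections, which describes `ψ_{1,1}` on the
quotient of `F_n` by the squares of the generators. -/
def transvectionRep (n : ℕ) : TGroup n →* RAut (FreeGroup ℕ) :=
  TGroup.lift (fun i => MulOpposite.op (transvection (i.1 + 1) 2)) (by
    intro i j hij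
    rw [lt_abs] at hij
    apply MulOpposite.unop_injective
    exact (transvection_commute (c := j.1 + 1) (d := i.1 + 1) 2 2 (by omega) (by omega)).eq)

theorem transvectionRep_tau (i : Fin (n - 1)) :
    transvectionRep n (tau i) = MulOpposite.op (transvection (i.1 + 1) 2) :=
  TGroup.lift_tau _ _ i

theorem transvectionRep_tau_zpow_act (i : Fin (n - 1)) (m : ℤ) (x : FreeGroup ℕ) :
    (transvectionRep n (tau i ^ m)).act x = transvectionHom (i.1 + 1) (2 * m) x := by
  rw [map_zpow, transvectionRep_tau, ← transvection_apply, ← transvection_zpow]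
  rfl

theorem transvectionRep_tau_act (i : Fin (n - 1)) (x : FreeGroup ℕ) :
    (transvectionRep n (tau i)).act x = transvectionHom (i.1 + 1) 2 x := by
  simpa using transvectionRep_tau_zpow_act i 1 x

theorem transvectionRep_injective (n : ℕ) : Function.Injective (transvectionRep n) := by
  rw [← MonoidHom.ker_eq_bot_iff, eq_bot_iff]
  intro g hg
  rw [Subgroup.mem_bot]
  by_contra h
  have habs : ∀ m : ℤ, m ≠ 0 → 1 < |2 * m| := by
    intro m hm
    rw [lt_abs]; omega
  obtain ⟨i, hi⟩ := TGroup.exists_mem_of_pingPong (fun g x => (transvectionRep n g).act x)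
    (fun g h x => by simp only [map_mul, RAut.act_mul]) (fun i => squareWords (i.1 + 1))
    -- This length provides a pair y_i y_{i+2}^{-1} for each of the n − 1 generators.
    (FreeGroup.mk (baseWord (n - 1)))
    (fun i m hm => by
      simp only [transvectionRep_tau_zpow_act]
      exact transvectionHom_baseWord_mem i.2 (habs m hm))
    (fun i j hij m hm x hx => by
      simp only [transvectionRep_tau_zpow_act]
      exact transvectionHom_mem_squareWords (by omega) (habs m hm) hx)
    (fun i j hij m x hx => by
      simp only [transvectionRep_tau_zpow_act]
      rw [lt_abs] at hij
      exact transvectionHom_mem_squareWords_of_ne (by omega) (by omega) (by omega) _ hx) h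
  rw [MonoidHom.mem_ker.1 hg] at hi
  exact mk_baseWord_not_mem_squareWords _ _ hi

/-- The product `y_0 y_1 ⋯ y_j`. -/
def prefixProd : ℕ → FreeGroup ℕ
  | 0 => FreeGroup.of 0
  | j + 1 => prefixProd j * FreeGroup.of (j + 1)

/-- The factor y_{i+1}^{-m} created after y_i commutes with y_{i+1} and is cancelled by the
y_{i+1}^m before y_{i+2}; only two prefixes change. -/
theorem transvectionHom_prefixProd (i : ℕ) (m : ℤ) (j : ℕ) :
    transvectionHom (i + 1) m (prefixProd j) =
      prefixProd j * FreeGroup.of (i + 1) ^ (if j = i ∨ j = i + 1 then -m else 0) := by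
  induction j with
  | zero =>
    rw [prefixProd, transvectionHom_of]
    unfold leftShift rightShift
    by_cases h : i = 0
    · rw [if_neg (by omega), if_pos (by omega), if_pos (by omega)]
      group
    · rw [if_neg (by omega), if_neg (by omega), if_neg (by omega)]
      group
  | succ j ih =>
    rw [prefixProd, map_mul, ih, transvectionHom_of]
    unfold leftShift rightShift
    by_cases h1 : j + 1 = i
    · rw [if_neg (by omega), if_neg (by omega), if_pos (by omega), if_pos (by omega)]
      group
    · by_cases h2 : j = i
      · subst h2
        rw [if_pos (by omega), if_neg (by omega), if_neg (by omega), if_pos (by omega)]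
        group
      · by_cases h3 : j = i + 1
        · rw [if_pos (by omega), if_pos (by omega), if_neg (by omega), if_neg (by omega)]
          group
        · rw [if_neg (by omega), if_neg (by omega), if_neg (by omega), if_neg (by omega)]
          group

/-- The involution of two copies of a group `E` which maps the first copy to the second one by
left multiplication with `v`. -/
def flipPerm {E : Type} [Group E] (v : E) : Equiv.Perm (E × Bool) :=
  Function.Involutive.toPerm (fun z => (if z.2 then v⁻¹ * z.1 else v * z.1, !z.2)) (by
    rintro ⟨e, b | b⟩ <;> simp)

theorem flipPerm_apply {E : Type} [Group E] (v : E) (z : E × Bool) :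
    flipPerm v z = (if z.2 then v⁻¹ * z.1 else v * z.1, !z.2) := rfl

theorem flipPerm_inv {E : Type} [Group E] (v : E) : (flipPerm v)⁻¹ = flipPerm v := rfl

/-- The automorphism `f` acting on two copies of a group. -/
def twoCopies {E : Type} [Group E] (f : RAut E) (z : E × Bool) : E × Bool := (f.act z.1, z.2)

theorem twoCopies_flipPerm {E : Type} [Group E] (f : RAut E) (v : E) (z : E × Bool) :
    twoCopies f (flipPerm v z) = flipPerm (f.act v) (twoCopies f z) := by
  obtain ⟨e, b | b⟩ := z <;>
    simp [twoCopies, flipPerm_apply, RAut.act_map_mul, RAut.act_map_inv]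

/-- `F_n` acting through the free product of `n` groups of order two. -/
def involutionRep (n : ℕ) : FreeGroup (Fin n) →* Equiv.Perm (FreeGroup ℕ × Bool) :=
  FreeGroup.lift fun j => flipPerm (prefixProd j.1)

theorem involutionRep_of (j : Fin n) :
    involutionRep n (FreeGroup.of j) = flipPerm (prefixProd j.1) := FreeGroup.lift_apply_of

/-- ψ_{1,1}(τ_i) conjugates both x_i and x_{i+1} by x_{i+1}x_i. A product of two flips is a
translation on each copy, so this conjugation multiplies the flip parameters on the right by
y_{i+1}^{-2}. -/
theorem involutionRep_psi_tau (i : Fin (n - 1)) (j : Fin n) :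
    involutionRep n ((psi n 1 1 (tau i)).1.act (FreeGroup.of j)) =
      flipPerm ((transvectionRep n (tau i)).act (prefixProd j.1)) := by
  have hy : FreeGroup.of (i.1 + 1) = (prefixProd i.1)⁻¹ * prefixProd (i.1 + 1) := by
    rw [prefixProd, inv_mul_cancel_left]
  rw [transvectionRep_tau_act, transvectionHom_prefixProd, hy]
  by_cases h1 : j = lowIdx i
  · subst h1
    rw [psi_tau_act_low, if_pos (by simp [lowIdx])]
    simp only [map_mul, zpow_neg, zpow_one, map_inv, involutionRep_of, flipPerm_inv]
    ext1 ⟨e, b | b⟩ <;>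
      simp [flipPerm_apply, lowIdx, highIdx, zpow_ofNat, pow_two, mul_assoc]
  · by_cases h2 : j = highIdx i
    · subst h2
      rw [psi_tau_act_high, if_pos (by simp [highIdx])]
      simp only [map_mul, zpow_neg, zpow_one, map_inv, involutionRep_of, flipPerm_inv]
      ext1 ⟨e, b | b⟩ <;>
        simp [flipPerm_apply, lowIdx, highIdx, zpow_ofNat, pow_two, mul_assoc]
    · rw [psi_tau_act_of_ne _ _ h1 h2, involutionRep_of, if_neg, zpow_zero, mul_one]
      rintro (h | h)
      · exact h1 (Fin.ext h)
      · exact h2 (Fin.ext h)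

theorem twoCopies_involutionRep (t : TGroup n) (x : FreeGroup (Fin n))
    (z : FreeGroup ℕ × Bool) :
    twoCopies (transvectionRep n t) (involutionRep n x z) =
      involutionRep n ((psi n 1 1 t).1.act x) (twoCopies (transvectionRep n t) z) := by
  have ht : t ∈ Subgroup.closure (Set.range (tau : Fin (n - 1) → TGroup n)) := by
    rw [closure_range_tau]; trivial
  induction ht using Subgroup.closure_induction generalizing x z with
  | mem t ht =>
    obtain ⟨i, rfl⟩ := ht
    induction x using FreeGroup.induction_on generalizing z with
    | C1 => rw [RAut.act_one_right, map_one]; rfl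
    | of j => rw [involutionRep_psi_tau, involutionRep_of, twoCopies_flipPerm]
    | inv_of j ih =>
      have h := ih ((involutionRep n (FreeGroup.of j))⁻¹ z)
      rw [← Equiv.Perm.mul_apply, mul_inv_cancel, Equiv.Perm.one_apply] at h
      rw [RAut.act_map_inv, map_inv, map_inv, h, ← Equiv.Perm.mul_apply, inv_mul_cancel,
        Equiv.Perm.one_apply]
    | mul x y ihx ihy =>
      rw [RAut.act_map_mul, map_mul, map_mul, Equiv.Perm.mul_apply, Equiv.Perm.mul_apply, ihx, ihy]
  | one => simp only [map_one]; rfl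
  | mul s t hs ht ihs iht =>
    have h : ∀ z, twoCopies (transvectionRep n (s * t)) z =
        twoCopies (transvectionRep n t) (twoCopies (transvectionRep n s) z) := by
      intro z; rw [map_mul]; rfl
    rw [h, h, ihs, iht, map_mul, Subgroup.coe_mul, RAut.act_mul]
  | inv t ht ih =>
    have h1 : ∀ z, twoCopies (transvectionRep n t) (twoCopies (transvectionRep n t⁻¹) z) = z := by
      intro z
      change twoCopies (transvectionRep n t⁻¹ * transvectionRep n t) z = z
      rw [← map_mul, inv_mul_cancel, map_one]; rfl
    have h2 : ∀ z, twoCopies (transvectionRep n t⁻¹) (twoCopies (transvectionRep n t) z) = z := by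
      intro z
      change twoCopies (transvectionRep n t * transvectionRep n t⁻¹) z = z
      rw [← map_mul, mul_inv_cancel, map_one]; rfl
    have h3 : (psi n 1 1 t).1.act ((psi n 1 1 t⁻¹).1.act x) = x := by
      rw [← RAut.act_mul, ← Subgroup.coe_mul, ← map_mul, inv_mul_cancel, map_one]; rfl
    have h4 := ih ((psi n 1 1 t⁻¹).1.act x) (twoCopies (transvectionRep n t⁻¹) z)
    rw [h3, h1] at h4
    rw [← h4, h2]

theorem transvectionRep_act_prefixProd_of_le (t : TGroup n) {j : ℕ} (hj : n ≤ j) :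
    (transvectionRep n t).act (prefixProd j) = prefixProd j := by
  induction t using TGroup.induction_zpow with
  | one => rw [map_one]; rfl
  | mul t i m ih =>
    rw [map_mul, RAut.act_mul, ih, transvectionRep_tau_zpow_act, transvectionHom_prefixProd,
      if_neg (by omega), zpow_zero, mul_one]

theorem RAut.eq_one_of_act_prefixProd {f : RAut (FreeGroup ℕ)}
    (h : ∀ j, f.act (prefixProd j) = prefixProd j) : f = 1 := by
  apply RAut.ext_of
  rintro (_ | j)
  · exact h 0
  · have e : FreeGroup.of (j + 1) = (prefixProd j)⁻¹ * prefixProd (j + 1) := by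
      rw [prefixProd, inv_mul_cancel_left]
    rw [e, RAut.act_map_mul, RAut.act_map_inv, h, h]
    rfl

theorem psi_injective {k : ℤ} (hk : k ≠ 0) : Function.Injective (psi n k k) := by
  rw [← MonoidHom.ker_eq_bot_iff, eq_bot_iff]
  intro t ht
  have h1 : ∀ x, (psi n 1 1 t).1.act x = x := by
    intro x
    apply FreeGroup.powerMap_injective hk
    rw [powerMap_psi_act, MonoidHom.mem_ker.1 ht]
    rfl
  apply transvectionRep_injective n
  rw [map_one]
  apply RAut.eq_one_of_act_prefixProd
  intro j
  by_cases hj : j < n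
  -- A flip sends (1, false) to its own parameter, so evaluating there recovers the prefix.
  · have h2 := twoCopies_involutionRep t (FreeGroup.of ⟨j, hj⟩) (1, false)
    rw [h1, involutionRep_of, flipPerm_apply] at h2
    simpa [twoCopies, flipPerm_apply] using h2
  · exact transvectionRep_act_prefixProd_of_le t (not_lt.1 hj)

end Psi

theorem mainTheorem3 :
    -- `φ_k : T_n → Cb_n`: its values on generators, and faithfulness for `k ≠ 0`
    (∀ (n : ℕ) (k : ℤ),
      (∀ i : Fin (n - 1),
        phi n k (tau i) = eps (lowIdx i) (highIdx i) (lowIdx_ne_highIdx i) ^ k ∧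
        (phi n k (tau i)).1.act (FreeGroup.of (lowIdx i)) =
          FreeGroup.of (highIdx i) ^ (-k) * FreeGroup.of (lowIdx i) *
            FreeGroup.of (highIdx i) ^ k ∧
        ∀ j : Fin n, j ≠ lowIdx i →
          (phi n k (tau i)).1.act (FreeGroup.of j) = FreeGroup.of j) ∧
      (k ≠ 0 → Function.Injective (phi n k))) ∧
    -- `ψ_{k,k} : T_n → Cb_n`: its values on generators, and faithfulness for `k ≠ 0`
    (∀ (n : ℕ) (k : ℤ),
      (∀ i : Fin (n - 1),
        psi n k k (tau i) = eps (lowIdx i) (highIdx i) (lowIdx_ne_highIdx i) ^ k *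
          eps (highIdx i) (lowIdx i) (lowIdx_ne_highIdx i).symm ^ k ∧
        (psi n k k (tau i)).1.act (FreeGroup.of (lowIdx i)) =
          FreeGroup.of (lowIdx i) ^ (-k) * FreeGroup.of (highIdx i) ^ (-k) *
            FreeGroup.of (lowIdx i) * FreeGroup.of (highIdx i) ^ k *
            FreeGroup.of (lowIdx i) ^ k ∧
        (psi n k k (tau i)).1.act (FreeGroup.of (highIdx i)) =
          FreeGroup.of (lowIdx i) ^ (-k) * FreeGroup.of (highIdx i) *
            FreeGroup.of (lowIdx i) ^ k ∧
        ∀ j : Fin n, j ≠ lowIdx i → j ≠ highIdx i →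
          (psi n k k (tau i)).1.act (FreeGroup.of j) = FreeGroup.of j) ∧
      (k ≠ 0 → Function.Injective (psi n k k))) ∧
    -- `ξ : T_n → Aut(F_{3n-2})`: its values on generators
    (∀ (n : ℕ) (i : Fin (n - 1)),
      (xi n (tau i)).act (FreeGroup.of (.x (lowIdx i))) =
        FreeGroup.of (.x (lowIdx i)) * FreeGroup.of (.y1 i) ∧
      (xi n (tau i)).act (FreeGroup.of (.x (highIdx i))) =
        FreeGroup.of (.x (highIdx i)) * FreeGroup.of (.y2 i) ∧
      (∀ j : Fin n, j ≠ lowIdx i → j ≠ highIdx i →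
        (xi n (tau i)).act (FreeGroup.of (.x j)) = FreeGroup.of (.x j)) ∧
      (∀ m : Fin (n - 1),
        (xi n (tau i)).act (FreeGroup.of (.y1 m)) = FreeGroup.of (.y1 m) ∧
        (xi n (tau i)).act (FreeGroup.of (.y2 m)) = FreeGroup.of (.y2 m))) ∧
    -- `ξ` is faithful for `n = 3` and has non-trivial kernel for `n ≥ 4`
    Function.Injective (xi 3) ∧
    (∀ n : ℕ, 4 ≤ n → (xi n).ker ≠ ⊥) := by
  refine ⟨fun n k => ⟨fun i => ⟨phi_tau k i, ?_, fun j hj => ?_⟩, fun hk => phi_injective hk⟩,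
    fun n k => ⟨fun i => ⟨psi_tau k k i, psi_tau_act_low k i, psi_tau_act_high k i,
      fun j h1 h2 => psi_tau_act_of_ne k i h1 h2⟩, fun hk => psi_injective hk⟩,
    fun n i => ⟨?_, ?_, fun j h1 h2 => ?_, fun m => xi_act_y _ m⟩,
    xi_three_injective, fun n hn => xi_ker_ne_bot hn⟩
  · simpa [phiAct] using phiAct_tau_zpow_low k i 1
  · simpa [phiAct] using phiAct_tau_zpow_of_ne k i 1 hj
  · rw [xi_tau_act, xiAut_x, if_pos rfl]
  · rw [xi_tau_act, xiAut_x, if_neg (lowIdx_ne_highIdx i).symm, if_pos rfl]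
  · rw [xi_tau_act, xiAut_x, if_neg h1, if_neg h2]
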